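/- All Hilbert spaces are finite-dimensional over $\mathbb{C}$; tensor products carry the tensor product inner product, $H^*$ carries the inner product for which $h\mapsto\langle h,-\rangle$ is antiunitary, and canonical associators and unitors are suppressed. For a Hilbert space $H$ with orthonormal basis $(e_i)$ let $\mathrm{cap}: H^*\otimes H\to\mathbb{C}$, $\phi\otimes h\mapsto\phi(h)$ (and likewise $H\otimes H^*\to\mathbb{C}$), and let $\mathrm{cup}:\mathbb{C}\to H\otimes H^*$, $1\mapsto\sum_i e_i\otimes\langle e_i,-\rangle$ (and likewise $\mathbb{C}\to H^*\otimes H$). **Definitions.** A *dagger Frobenius algebra* is a Hilbert space $A$ with linear maps $m:A\otimes A\to A$ and $u:\mathbb{C}\to A$ that are associative and unital and satisfy $(m\otimes 1)(1\otimes m^\dagger)=m^\dagger m=(1\otimes m)(m^\dagger\otimes 1)$. It is *special* if $mm^\dagger=1$ and *symmetric* if $u^\dagger m$ is invariant under the swap of $A\otimes A$. Write $\mathrm{cap}_A=u^\dagger m$ and $\mathrm{cup}_A=m^\dagger u$. A linear map $f:A\to B$ of dagger Frobenius algebras is a *$*$-isomorphism* if it preserves multiplication, unit, comultiplication $m^\dagger$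 and counit $u^\dagger$ and if $f^\dagger=(1_A\otimes \mathrm{cap}_B)(1_A\otimes f\otimes 1_B)(\mathrm{cup}_A\otimes 1_B)$. The *endomorphism algebra* of $H$, $n=\dim H$, is $H\otimes H^*$ with multiplication $\frac1{\sqrt n}(1_H\otimes\mathrm{cap}\otimes1_{H^*})$ and unit $\sqrt n\,\mathrm{cup}$. A *quantum graph* $(V_\Gamma,\Gamma)$ is a special symmetric dagger Frobenius algebra $V_\Gamma$ with a self-adjoint linear map $\Gamma:V_\Gamma\to V_\Gamma$ such that $m(\Gamma\otimes\Gamma)m^\dagger=\Gamma$, $(1\otimes \mathrm{cap}_{V_\Gamma})(1\otimes\Gamma\otimes1)(\mathrm{cup}_{V_\Gamma}\otimes1)=\Gamma$ and $m(\Gamma\otimes1)m^\dagger=1$. A *quantum isomorphism* $(H,P):\Gamma\to\Gamma'$ is a Hilbert space $H$ with a linear map $P:H\otimes V_\Gamma\to V_{\Gamma'}\otimes H$ such that, with $m,u$ and $m',u'$ the structure maps of $V_\Gamma$ and $V_{\Gamma'}$, $$(m'^\dagger\otimes1)P=(1\otimes P)(P\otimes1)(1\otimes m^\dagger),\qquad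 (u'^\dagger\otimes1)P=1\otimes u^\dagger,$$ $$P(1\otimes m)=(m'\otimes1)(1\otimes P)(P\otimes1),\qquad P(1\otimes u)=u'\otimes1,\qquad P(1\otimes\Gamma)=(\Gamma'\otimes1)P,$$ $$P^\dagger=(\mathrm{cap}_{V_{\Gamma'}}\otimes1_{H}\otimes 1_{V_\Gamma})(1\otimes P\otimes1)(1_{V_{\Gamma'}}\otimes 1_H\otimes\mathrm{cup}_{V_\Gamma}).$$ An *intertwiner* $(H,P)\to(K,Q)$ is a linear map $f:H\to K$ with $Q(f\otimes1)=(1\otimes f)P$. The composite of $(H,P):\Gamma\to\Gamma'$ and $(K,Q):\Gamma'\to\Gamma''$ is $(K\otimes H,\,Q\circ P)$ with $Q\circ P=(Q\otimes1_H)(1_K\otimes P)$. The dual of $(H,P)$ is $(H^*,\overline P):\Gamma'\to\Gamma$ with $\overline P=(\mathrm{cap}\otimes1)(1_{H^*}\otimes P^\dagger\otimes1_{H^*})(1\otimes\mathrm{cup}):H^*\otimes V_{\Gamma'}\to V_\Gamma\otimes H^*$. $\mathrm{QAut}(\Gamma)$ is the monoidal dagger category of quantum isomorphisms $\Gamma\to\Gamma$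 and intertwiners, with composition of quantum isomorphisms as monoidal product. A *dagger Frobenius monoid* in $\mathrm{QAut}(\Gamma)$ is a quantum isomorphism $(K,X):\Gamma\to\Gamma$ with a dagger Frobenius algebra structure on $K$ whose multiplication $(K\otimes K,X\circ X)\to(K,X)$ and unit $(\mathbb{C},1)\to(K,X)$ are intertwiners. It is *simple* if the dagger Frobenius algebra $K$ is $*$-isomorphic to the endomorphism algebra of some Hilbert space. A *$*$-isomorphism* of dagger Frobenius monoids in $\mathrm{QAut}(\Gamma)$ is an intertwiner that is a $*$-isomorphism of the underlying algebras. **Theorem.** Let $\Gamma$ be a quantum graph and let $X$ be a simple dagger Frobenius monoid in $\mathrm{QAut}(\Gamma)$. Then there are a quantum graph $\Gamma_X$ and a quantum isomorphism $(H,P):\Gamma_X\to\Gamma$ such that $(H\otimes H^*,P\circ\overline P)$, with the endomorphism algebra of $H$, is a dagger Frobenius monoid in $\mathrm{QAut}(\Gamma)$ that is $*$-isomorphic to $X$. Moreover, $\Gamma_X$ and $P$ can be chosen as follows. Put $n=\dim H$, $Y=P\circ\overline P$ and $A=V_{\Gamma_X}$ (for $n=0$ read $\frac1n$ as $0$). The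 endomorphism $$y(\phi\otimes v\otimes h)=\tfrac1n\sum_i\langle e_i,-\rangle\otimes(1_{V_\Gamma}\otimes1_H\otimes\mathrm{cap})\bigl(Y(e_i\otimes\phi\otimes v)\otimes h\bigr)$$ of $H^*\otimes V_\Gamma\otimes H$ satisfies $y^2=y=y^\dagger$, and there is a linear map $i:A\to H^*\otimes V_\Gamma\otimes H$ with $i^\dagger i=1$, $ii^\dagger=y$ and $P=\sqrt n\,(\mathrm{cap}\otimes1_{V_\Gamma}\otimes1_H)(1_H\otimes i)$. With $m,u$ the structure maps of $V_\Gamma$ and $\mathrm{Tr}_H$ the partial trace over $H$, the multiplication, the unit and the adjacency matrix of $\Gamma_X$ are $$\tfrac1n\mathrm{Tr}_H\bigl[P^\dagger(m\otimes1_H)(1_{V_\Gamma}\otimes P)(P\otimes1_A)\bigr],\qquad \tfrac1n\mathrm{Tr}_H\bigl[P^\dagger(u\otimes1_H)\bigr],\qquad \tfrac1n\mathrm{Tr}_H\bigl[P^\dagger(\Gamma\otimes1_H)P\bigr].$$ -/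

import Mathlib

open scoped TensorProduct

set_option maxSynthPendingDepth 3

universe u v

namespace QuantumGraphs

noncomputable section

/-! ### Finite-dimensional Hilbert spaces: duals, cups and caps -/

/-- The dual space `H^*` of a finite-dimensional Hilbert space `H`: the space of continuous linear
functionals on `H` with the operator norm. It is again a Hilbert space, with the inner product for
which `h ↦ ⟪h, -⟫` is an antiunitary. -/
def HilbDual (H : Type*) [NormedAddCommGroup H] [InnerProductSpace ℂ H] : Type _ :=
  StrongDual ℂ H

instance HilbDual.instNormedAddCommGroup (H : Type*) [NormedAddCommGroup H]
    [InnerProductSpace ℂ H] : NormedAddCommGroup (HilbDual H) :=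
  inferInstanceAs (NormedAddCommGroup (StrongDual ℂ H))

instance HilbDual.instInnerProductSpace (H : Type*) [NormedAddCommGroup H] [InnerProductSpace ℂ H]
    [FiniteDimensional ℂ H] : InnerProductSpace ℂ (HilbDual H) :=
  haveI : CompleteSpace H := FiniteDimensional.complete ℂ H
  { (inferInstanceAs (NormedSpace ℂ (StrongDual ℂ H)) : NormedSpace ℂ (HilbDual H)) with
    inner := fun φ ψ =>
      inner ℂ ((InnerProductSpace.toDual ℂ H).symm ψ) ((InnerProductSpace.toDual ℂ H).symm φ)
    norm_sq_eq_re_inner := fun φ => by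
      rw [inner_self_eq_norm_sq]
      exact congrArg (fun r : ℝ => r ^ 2)
        (LinearIsometryEquiv.norm_map (InnerProductSpace.toDual ℂ H).symm φ).symm
    conj_inner_symm := fun φ ψ => inner_conj_symm _ _
    add_left := fun φ ψ χ => by
      rw [← inner_add_right]; exact congrArg _ (map_add (InnerProductSpace.toDual ℂ H).symm φ ψ)
    smul_left := fun φ ψ r => by
      rw [← inner_smul_right]
      exact congrArg _ (LinearIsometryEquiv.map_smulₛₗ (InnerProductSpace.toDual ℂ H).symm r φ) }

/-- The identification of `H^*` with the space of continuous linear functionals on `H`. -/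
def HilbDual.equiv (H : Type*) [NormedAddCommGroup H] [InnerProductSpace ℂ H]
    [FiniteDimensional ℂ H] : HilbDual H ≃ₗ[ℂ] StrongDual ℂ H :=
  LinearEquiv.refl ℂ (StrongDual ℂ H)

instance HilbDual.instFiniteDimensional (H : Type*) [NormedAddCommGroup H] [InnerProductSpace ℂ H]
    [FiniteDimensional ℂ H] : FiniteDimensional ℂ (HilbDual H) :=
  Module.Finite.equiv (HilbDual.equiv H).symm

section CupsCaps

variable (H : Type*) [NormedAddCommGroup H] [InnerProductSpace ℂ H] [FiniteDimensional ℂ H]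

/-- The cap `H^* ⊗ H → ℂ`, `f ⊗ v ↦ f v`. -/
def capDual : HilbDual H ⊗[ℂ] H →ₗ[ℂ] ℂ :=
  TensorProduct.lift (ContinuousLinearMap.coeLM ℂ ∘ₗ (HilbDual.equiv H).toLinearMap)

/-- The cap `H ⊗ H^* → ℂ`, `v ⊗ f ↦ f v`. -/
def cap : H ⊗[ℂ] HilbDual H →ₗ[ℂ] ℂ :=
  capDual H ∘ₗ (TensorProduct.comm ℂ H (HilbDual H)).toLinearMap

/-- The cup `ℂ → H ⊗ H^*`, `1 ↦ ∑ i, e i ⊗ ⟪e i, -⟫` for an orthonormal basis `e` of `H`; this is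
the element that corresponds to the identity under `H ⊗ H^* ≅ End H`. -/
def cup : ℂ →ₗ[ℂ] H ⊗[ℂ] HilbDual H :=
  LinearMap.toSpanSingleton ℂ _
    (∑ i, stdOrthonormalBasis ℂ H i ⊗ₜ[ℂ] (HilbDual.equiv H).symm (innerSL ℂ (stdOrthonormalBasis ℂ H i)))

/-- The cup `ℂ → H^* ⊗ H`, `1 ↦ ∑ i, ⟪e i, -⟫ ⊗ e i`. -/
def cupDual : ℂ →ₗ[ℂ] HilbDual H ⊗[ℂ] H :=
  (TensorProduct.comm ℂ H (HilbDual H)).toLinearMap ∘ₗ cup H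

end CupsCaps

/-! ### Dagger Frobenius algebras -/

section Algebras

variable {A B : Type*}
  [NormedAddCommGroup A] [InnerProductSpace ℂ A] [FiniteDimensional ℂ A]
  [NormedAddCommGroup B] [InnerProductSpace ℂ B] [FiniteDimensional ℂ B]

/-- A multiplication and a unit on a vector space, without any laws. -/
structure AlgData (A : Type*) [NormedAddCommGroup A] [InnerProductSpace ℂ A] where
  /-- the multiplication `m : A ⊗ A → A` -/
  mul : A ⊗[ℂ] A →ₗ[ℂ] A
  /-- the unit `u : ℂ → A` -/
  unit : ℂ →ₗ[ℂ] A

namespace AlgData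

/-- The comultiplication: the Hilbert space adjoint of the multiplication. -/
def comul (M : AlgData A) : A →ₗ[ℂ] A ⊗[ℂ] A := LinearMap.adjoint M.mul

/-- The counit: the Hilbert space adjoint of the unit. -/
def counit (M : AlgData A) : A →ₗ[ℂ] ℂ := LinearMap.adjoint M.unit

/-- The cap `A ⊗ A → ℂ`: multiplication followed by the counit. -/
def frobCap (M : AlgData A) : A ⊗[ℂ] A →ₗ[ℂ] ℂ := M.counit ∘ₗ M.mul

/-- The cup `ℂ → A ⊗ A`: the unit followed by the comultiplication. -/
def frobCup (M : AlgData A) : ℂ →ₗ[ℂ] A ⊗[ℂ] A := M.comul ∘ₗ M.unit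

/-- The laws of a dagger Frobenius algebra: associativity, unitality and the two Frobenius
equations, which relate the algebra and its adjoint coalgebra. -/
structure IsDaggerFrobenius (M : AlgData A) : Prop where
  mul_assoc : M.mul ∘ₗ M.mul.rTensor A =
    M.mul ∘ₗ M.mul.lTensor A ∘ₗ (TensorProduct.assoc ℂ A A A).toLinearMap
  unit_mul : M.mul ∘ₗ M.unit.rTensor A = (TensorProduct.lid ℂ A).toLinearMap
  mul_unit : M.mul ∘ₗ M.unit.lTensor A = (TensorProduct.rid ℂ A).toLinearMap
  frobenius_left : M.mul.rTensor A ∘ₗ (TensorProduct.assoc ℂ A A A).symm.toLinearMap ∘ₗ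
    M.comul.lTensor A = M.comul ∘ₗ M.mul
  frobenius_right : M.mul.lTensor A ∘ₗ (TensorProduct.assoc ℂ A A A).toLinearMap ∘ₗ
    M.comul.rTensor A = M.comul ∘ₗ M.mul

/-- A dagger Frobenius algebra is special if multiplication after comultiplication is the
identity. -/
def IsSpecial (M : AlgData A) : Prop := M.mul ∘ₗ M.comul = LinearMap.id

/-- A dagger Frobenius algebra is symmetric if the cap is invariant under the swap. -/
def IsSymmetric (M : AlgData A) : Prop :=
  M.frobCap ∘ₗ (TensorProduct.comm ℂ A A).toLinearMap = M.frobCap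

end AlgData

/-- The endomorphism algebra of a Hilbert space `H` of dimension `n`, on `H ⊗ H^*`: the
multiplication is `(1 / √n) • (id ⊗ cap ⊗ id)` and the unit is `√n • cup`. -/
def endAlg (H : Type*) [NormedAddCommGroup H] [InnerProductSpace ℂ H] [FiniteDimensional ℂ H] :
    AlgData (H ⊗[ℂ] HilbDual H) where
  mul := ((1 / Real.sqrt (Module.finrank ℂ H) : ℝ) : ℂ) •
    ((TensorProduct.lid ℂ (HilbDual H)).toLinearMap ∘ₗ
      (capDual H).rTensor (HilbDual H) ∘ₗ
      (TensorProduct.assoc ℂ (HilbDual H) H (HilbDual H)).symm.toLinearMap).lTensor H ∘ₗ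
    (TensorProduct.assoc ℂ H (HilbDual H) (H ⊗[ℂ] HilbDual H)).toLinearMap
  unit := ((Real.sqrt (Module.finrank ℂ H) : ℝ) : ℂ) • cup H

/-- The map `B → A` obtained from `f : A → B` by bending its input with the Frobenius cup of `A`
and its output with the Frobenius cap of `B`:
`b ↦ (id_A ⊗ cap_B) (id_A ⊗ f ⊗ id_B) (cup_A ⊗ b)`. -/
def frobTranspose (M : AlgData A) (N : AlgData B) (f : A →ₗ[ℂ] B) : B →ₗ[ℂ] A :=
  (TensorProduct.rid ℂ A).toLinearMap ∘ₗ
    (N.frobCap ∘ₗ f.rTensor B).lTensor A ∘ₗ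
    (TensorProduct.assoc ℂ A A B).toLinearMap ∘ₗ
    M.frobCup.rTensor B ∘ₗ (TensorProduct.lid ℂ B).symm.toLinearMap

/-- `f` is a `*`-homomorphism: it preserves multiplication, unit and involution. -/
structure IsStarHom (M : AlgData A) (N : AlgData B) (f : A →ₗ[ℂ] B) : Prop where
  map_mul : f ∘ₗ M.mul = N.mul ∘ₗ TensorProduct.map f f
  map_unit : f ∘ₗ M.unit = N.unit
  adjoint_eq : LinearMap.adjoint f = frobTranspose M N f

/-- `f` is a `*`-cohomomorphism: it preserves comultiplication, counit and involution. -/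
structure IsStarCohom (M : AlgData A) (N : AlgData B) (f : A →ₗ[ℂ] B) : Prop where
  map_comul : N.comul ∘ₗ f = TensorProduct.map f f ∘ₗ M.comul
  map_counit : N.counit ∘ₗ f = M.counit
  adjoint_eq : LinearMap.adjoint f = frobTranspose M N f

/-- A `*`-isomorphism is a map that is both a `*`-homomorphism and a `*`-cohomomorphism. -/
structure IsStarIso (M : AlgData A) (N : AlgData B) (f : A →ₗ[ℂ] B) : Prop where
  starHom : IsStarHom M N f
  starCohom : IsStarCohom M N f

end Algebras

/-! ### Quantum graphs and quantum isomorphisms -/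

/-- A quantum graph with quantum set of vertices on the Hilbert space `V`: a special symmetric
dagger Frobenius algebra on `V` with a quantum adjacency matrix `adj : V → V`. -/
structure QuantumGraph (V : Type*) [NormedAddCommGroup V] [InnerProductSpace ℂ V]
    [FiniteDimensional ℂ V] where
  /-- the algebra structure on `V` -/
  alg : AlgData V
  frobenius : alg.IsDaggerFrobenius
  special : alg.IsSpecial
  symmetric : alg.IsSymmetric
  /-- the quantum adjacency matrix -/
  adj : V →ₗ[ℂ] V
  adj_selfAdjoint : LinearMap.adjoint adj = adj
  adj_idem : alg.mul ∘ₗ TensorProduct.map adj adj ∘ₗ alg.comul = adj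
  adj_symm : frobTranspose alg alg adj = adj
  adj_refl : alg.mul ∘ₗ adj.rTensor V ∘ₗ alg.comul = LinearMap.id

section QuantumIso

variable {V W Z H K : Type*}
  [NormedAddCommGroup V] [InnerProductSpace ℂ V] [FiniteDimensional ℂ V]
  [NormedAddCommGroup W] [InnerProductSpace ℂ W] [FiniteDimensional ℂ W]
  [NormedAddCommGroup Z] [InnerProductSpace ℂ Z] [FiniteDimensional ℂ Z]
  [NormedAddCommGroup H] [InnerProductSpace ℂ H] [FiniteDimensional ℂ H]
  [NormedAddCommGroup K] [InnerProductSpace ℂ K] [FiniteDimensional ℂ K]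

/-- `H ⊗ (V ⊗ V) → (W ⊗ W) ⊗ H`: pull `H` through two wires, using `P` twice. -/
def pullTwo (P : H ⊗[ℂ] V →ₗ[ℂ] W ⊗[ℂ] H) : H ⊗[ℂ] (V ⊗[ℂ] V) →ₗ[ℂ] (W ⊗[ℂ] W) ⊗[ℂ] H :=
  (TensorProduct.assoc ℂ W W H).symm.toLinearMap ∘ₗ P.lTensor W ∘ₗ
    (TensorProduct.assoc ℂ W H V).toLinearMap ∘ₗ P.rTensor V ∘ₗ
    (TensorProduct.assoc ℂ H V V).symm.toLinearMap

/-- `H ⊗ ℂ → ℂ ⊗ H`: the swap with the trivial wire. -/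
def pullZero (H : Type*) [NormedAddCommGroup H] [InnerProductSpace ℂ H] :
    H ⊗[ℂ] ℂ →ₗ[ℂ] ℂ ⊗[ℂ] H :=
  (TensorProduct.comm ℂ H ℂ).toLinearMap

/-- The rotation `W ⊗ H → H ⊗ V` of `P : H ⊗ V → W ⊗ H` in which the algebra wires are bent with
the Frobenius cup of `V` and the Frobenius cap of `W`:
`w ⊗ h ↦ (cap_W ⊗ id_H ⊗ id_V) (w ⊗ (P ⊗ id_V) (h ⊗ cup_V))`. -/
def rotateAlg (M : AlgData V) (N : AlgData W) (P : H ⊗[ℂ] V →ₗ[ℂ] W ⊗[ℂ] H) :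
    W ⊗[ℂ] H →ₗ[ℂ] H ⊗[ℂ] V :=
  (TensorProduct.lid ℂ (H ⊗[ℂ] V)).toLinearMap ∘ₗ
    N.frobCap.rTensor (H ⊗[ℂ] V) ∘ₗ
    (TensorProduct.assoc ℂ W W (H ⊗[ℂ] V)).symm.toLinearMap ∘ₗ
    ((TensorProduct.assoc ℂ W H V).toLinearMap ∘ₗ P.rTensor V ∘ₗ
      (TensorProduct.assoc ℂ H V V).symm.toLinearMap ∘ₗ
      M.frobCup.lTensor H ∘ₗ (TensorProduct.rid ℂ H).symm.toLinearMap).lTensor W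

/-- A quantum isomorphism `(H, P) : Γ → Γ'`: a linear map `P : H ⊗ V → V' ⊗ H` that is compatible
with the (co)multiplications, the (co)units and the adjacency matrices, and whose adjoint is its
rotation. -/
structure QuantumIso (Γ : QuantumGraph V) (Γ' : QuantumGraph W) (H : Type*)
    [NormedAddCommGroup H] [InnerProductSpace ℂ H] [FiniteDimensional ℂ H] where
  /-- the underlying linear map -/
  map : H ⊗[ℂ] V →ₗ[ℂ] W ⊗[ℂ] H
  map_comul : Γ'.alg.comul.rTensor H ∘ₗ map = pullTwo map ∘ₗ Γ.alg.comul.lTensor H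
  map_counit : Γ'.alg.counit.rTensor H ∘ₗ map = pullZero H ∘ₗ Γ.alg.counit.lTensor H
  adjoint_eq : LinearMap.adjoint map = rotateAlg Γ.alg Γ'.alg map
  map_mul : map ∘ₗ Γ.alg.mul.lTensor H = Γ'.alg.mul.rTensor H ∘ₗ pullTwo map
  map_unit : map ∘ₗ Γ.alg.unit.lTensor H = Γ'.alg.unit.rTensor H ∘ₗ pullZero H
  map_adj : map ∘ₗ Γ.adj.lTensor H = Γ'.adj.rTensor H ∘ₗ map

/-- `f : H → K` is an intertwiner from `(H, P)` to `(K, Q)`. -/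
def IsIntertwiner (P : H ⊗[ℂ] V →ₗ[ℂ] W ⊗[ℂ] H) (Q : K ⊗[ℂ] V →ₗ[ℂ] W ⊗[ℂ] K)
    (f : H →ₗ[ℂ] K) : Prop :=
  Q ∘ₗ f.rTensor V = f.lTensor W ∘ₗ P

/-- The composition `(K ⊗ H, Q ∘ P)` of `(H, P) : V → W` and `(K, Q) : W → Z`. -/
def compMap (Q : K ⊗[ℂ] W →ₗ[ℂ] Z ⊗[ℂ] K) (P : H ⊗[ℂ] V →ₗ[ℂ] W ⊗[ℂ] H) :
    (K ⊗[ℂ] H) ⊗[ℂ] V →ₗ[ℂ] Z ⊗[ℂ] (K ⊗[ℂ] H) :=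
  (TensorProduct.assoc ℂ Z K H).toLinearMap ∘ₗ Q.rTensor H ∘ₗ
    (TensorProduct.assoc ℂ K W H).symm.toLinearMap ∘ₗ P.lTensor K ∘ₗ
    (TensorProduct.assoc ℂ K H V).toLinearMap

/-- The identity 1-morphism `(ℂ, ℂ ⊗ V ≅ V ⊗ ℂ)`, the monoidal unit of `QAut(Γ)`. -/
def idMap (V : Type*) [NormedAddCommGroup V] [InnerProductSpace ℂ V] :
    ℂ ⊗[ℂ] V →ₗ[ℂ] V ⊗[ℂ] ℂ :=
  (TensorProduct.comm ℂ ℂ V).toLinearMap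

/-- The dual `P̄ : H^* ⊗ W → V ⊗ H^*` of `P : H ⊗ V → W ⊗ H`, obtained from the adjoint of `P` by
bending the `H`-wires:
`f ⊗ w ↦ (cap_{H^*,H} ⊗ id_V ⊗ id_{H^*}) (id_{H^*} ⊗ P† ⊗ id_{H^*}) (f ⊗ w ⊗ cup_{H,H^*})`. -/
def dualMap (P : H ⊗[ℂ] V →ₗ[ℂ] W ⊗[ℂ] H) :
    HilbDual H ⊗[ℂ] W →ₗ[ℂ] V ⊗[ℂ] HilbDual H :=
  (TensorProduct.lid ℂ (V ⊗[ℂ] HilbDual H)).toLinearMap ∘ₗ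
    (capDual H).rTensor (V ⊗[ℂ] HilbDual H) ∘ₗ
    (TensorProduct.assoc ℂ (HilbDual H) H (V ⊗[ℂ] HilbDual H)).symm.toLinearMap ∘ₗ
    ((TensorProduct.assoc ℂ H V (HilbDual H)).toLinearMap ∘ₗ
      (LinearMap.adjoint P).rTensor (HilbDual H) ∘ₗ
      (TensorProduct.assoc ℂ W H (HilbDual H)).symm.toLinearMap ∘ₗ
      (cup H).lTensor W ∘ₗ (TensorProduct.rid ℂ W).symm.toLinearMap).lTensor (HilbDual H)

/-- A dagger Frobenius monoid in the monoidal dagger category `QAut(Γ)`, with underlying Hilbert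
space `K`: a quantum automorphism `(K, X)` of `Γ` with a dagger Frobenius structure on `K` whose
multiplication `(K, X) ⊗ (K, X) → (K, X)` and unit are intertwiners. -/
structure FrobeniusMonoid (Γ : QuantumGraph V) (K : Type*)
    [NormedAddCommGroup K] [InnerProductSpace ℂ K] [FiniteDimensional ℂ K] where
  /-- the underlying quantum automorphism -/
  iso : QuantumIso Γ Γ K
  /-- the underlying algebra in `Hilb` -/
  alg : AlgData K
  frobenius : alg.IsDaggerFrobenius
  mul_intertwiner : IsIntertwiner (compMap iso.map iso.map) iso.map alg.mul
  unit_intertwiner : IsIntertwiner (idMap V) iso.map alg.unit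

/-- A dagger Frobenius monoid in `QAut(Γ)` is simple if its underlying algebra is `*`-isomorphic
to the endomorphism algebra of a Hilbert space. -/
def FrobeniusMonoid.IsSimple {K : Type v} [NormedAddCommGroup K] [InnerProductSpace ℂ K]
    [FiniteDimensional ℂ K] {Γ : QuantumGraph V} (X : FrobeniusMonoid Γ K) : Prop :=
  ∃ (H : Type v) (_ : NormedAddCommGroup H) (_ : InnerProductSpace ℂ H)
    (_ : FiniteDimensional ℂ H) (f : K →ₗ[ℂ] H ⊗[ℂ] HilbDual H),
    IsStarIso X.alg (endAlg H) f

end QuantumIso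

/-! ### The splitting construction -/

section Splitting

variable {A B V W H : Type*}
  [NormedAddCommGroup A] [InnerProductSpace ℂ A] [FiniteDimensional ℂ A]
  [NormedAddCommGroup B] [InnerProductSpace ℂ B] [FiniteDimensional ℂ B]
  [NormedAddCommGroup V] [InnerProductSpace ℂ V] [FiniteDimensional ℂ V]
  [NormedAddCommGroup W] [InnerProductSpace ℂ W] [FiniteDimensional ℂ W]
  [NormedAddCommGroup H] [InnerProductSpace ℂ H] [FiniteDimensional ℂ H]

/-- The endomorphism of `H^* ⊗ V ⊗ H` obtained from `X : (H ⊗ H^*) ⊗ V → V ⊗ (H ⊗ H^*)` by bending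
one input `H`-wire and one output `H^*`-wire and dividing by `n = dim H`:
`f ⊗ v ⊗ h ↦ (1 / n) • ∑ i, ⟪e i, -⟫ ⊗ (id_V ⊗ id_H ⊗ cap) (X ((e i ⊗ f) ⊗ v) ⊗ h)`. -/
def bendEndo (X : (H ⊗[ℂ] HilbDual H) ⊗[ℂ] V →ₗ[ℂ] V ⊗[ℂ] (H ⊗[ℂ] HilbDual H)) :
    HilbDual H ⊗[ℂ] (V ⊗[ℂ] H) →ₗ[ℂ] HilbDual H ⊗[ℂ] (V ⊗[ℂ] H) :=
  (1 / (Module.finrank ℂ H : ℂ)) •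
    (((TensorProduct.rid ℂ H).toLinearMap ∘ₗ (capDual H).lTensor H ∘ₗ
        (TensorProduct.assoc ℂ H (HilbDual H) H).toLinearMap).lTensor V ∘ₗ
      (TensorProduct.assoc ℂ V (H ⊗[ℂ] HilbDual H) H).toLinearMap ∘ₗ
      X.rTensor H ∘ₗ
      (TensorProduct.assoc ℂ (H ⊗[ℂ] HilbDual H) V H).symm.toLinearMap ∘ₗ
      (TensorProduct.assoc ℂ H (HilbDual H) (V ⊗[ℂ] H)).symm.toLinearMap).lTensor
        (HilbDual H) ∘ₗ
    (TensorProduct.assoc ℂ (HilbDual H) H (HilbDual H ⊗[ℂ] (V ⊗[ℂ] H))).toLinearMap ∘ₗ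
    (cupDual H).rTensor (HilbDual H ⊗[ℂ] (V ⊗[ℂ] H)) ∘ₗ
    (TensorProduct.lid ℂ (HilbDual H ⊗[ℂ] (V ⊗[ℂ] H))).symm.toLinearMap

/-- The map `H ⊗ A → V ⊗ H` obtained from `i : A → H^* ⊗ V ⊗ H` by bending the `H^*`-wire and
multiplying by `√n`, where `n = dim H`. -/
def unbend (i : A →ₗ[ℂ] HilbDual H ⊗[ℂ] (V ⊗[ℂ] H)) : H ⊗[ℂ] A →ₗ[ℂ] V ⊗[ℂ] H :=
  ((Real.sqrt (Module.finrank ℂ H) : ℝ) : ℂ) •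
    (TensorProduct.lid ℂ (V ⊗[ℂ] H)).toLinearMap ∘ₗ
    (cap H).rTensor (V ⊗[ℂ] H) ∘ₗ
    (TensorProduct.assoc ℂ H (HilbDual H) (V ⊗[ℂ] H)).symm.toLinearMap ∘ₗ
    i.lTensor H

/-- The normalised partial trace over `H`, i.e. `1 / n` times the closed `H`-loop around a diagram,
where `n = dim H`. -/
def loop (T : H ⊗[ℂ] A →ₗ[ℂ] H ⊗[ℂ] B) : A →ₗ[ℂ] B :=
  (1 / (Module.finrank ℂ H : ℂ)) •
    (TensorProduct.lid ℂ B).toLinearMap ∘ₗ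
    (capDual H).rTensor B ∘ₗ
    (TensorProduct.assoc ℂ (HilbDual H) H B).symm.toLinearMap ∘ₗ
    T.lTensor (HilbDual H) ∘ₗ
    (TensorProduct.assoc ℂ (HilbDual H) H A).toLinearMap ∘ₗ
    (cupDual H).rTensor A ∘ₗ
    (TensorProduct.lid ℂ A).symm.toLinearMap

/-- The quantum graph `Γ'` on `A` and the map `P : H ⊗ A → V ⊗ H` arise from the quantum graph `Γ`
on `V` and from `X : (H ⊗ H^*) ⊗ V → V ⊗ (H ⊗ H^*)` by splitting the dagger idempotent `bendEndo X`
by an isometry `i : A → H^* ⊗ V ⊗ H`, by bending `i` to `P`, and by transporting multiplication,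
unit and adjacency matrix of `Γ` along `P`. -/
structure IsSplitting (Γ : QuantumGraph V)
    (X : (H ⊗[ℂ] HilbDual H) ⊗[ℂ] V →ₗ[ℂ] V ⊗[ℂ] (H ⊗[ℂ] HilbDual H))
    (Γ' : QuantumGraph A) (P : H ⊗[ℂ] A →ₗ[ℂ] V ⊗[ℂ] H)
    (i : A →ₗ[ℂ] HilbDual H ⊗[ℂ] (V ⊗[ℂ] H)) : Prop where
  bend_selfAdjoint : LinearMap.adjoint (𝕜 := ℂ) (bendEndo X) = bendEndo X
  bend_idem : bendEndo X ∘ₗ bendEndo X = bendEndo X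
  isometry : LinearMap.adjoint (𝕜 := ℂ) i ∘ₗ i = LinearMap.id
  splits : i ∘ₗ LinearMap.adjoint (𝕜 := ℂ) i = bendEndo X
  map_eq : P = unbend i
  mul_eq : Γ'.alg.mul = loop (LinearMap.adjoint P ∘ₗ Γ.alg.mul.rTensor H ∘ₗ pullTwo P)
  unit_eq : Γ'.alg.unit = loop (LinearMap.adjoint P ∘ₗ Γ.alg.unit.rTensor H ∘ₗ pullZero H)
  adj_eq : Γ'.adj = loop (LinearMap.adjoint P ∘ₗ Γ.adj.rTensor H ∘ₗ P)

end Splitting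

end

end QuantumGraphs

set_option linter.unusedSectionVars false

namespace QuantumGraphs

noncomputable section

open TensorProduct (mk)

/-! ### Matrix components with respect to an orthonormal basis -/

section Components

variable {ι κ V W Z A B H K : Type*} [Fintype ι] [Fintype κ] [DecidableEq ι] [DecidableEq κ]
  [NormedAddCommGroup V] [InnerProductSpace ℂ V]
  [NormedAddCommGroup W] [InnerProductSpace ℂ W]
  [NormedAddCommGroup Z] [InnerProductSpace ℂ Z]
  [NormedAddCommGroup A] [InnerProductSpace ℂ A]
  [NormedAddCommGroup B] [InnerProductSpace ℂ B]
  [NormedAddCommGroup H] [InnerProductSpace ℂ H]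
  [NormedAddCommGroup K] [InnerProductSpace ℂ K]

/-! Everything is computed in matrix components. After a choice of orthonormal basis of `H`, a map
`P : H ⊗ V → W ⊗ H` is a matrix of maps `P_ij : V → W`, and a quantum isomorphism is a unitary such
matrix with `P_ij m = m' ∑_k (P_kj ⊗ P_ik)`, `P_ij u = δ_ij u'` and `P_ij Γ = Γ' P_ij`. The
conditions on comultiplication, counit and adjoint then follow from unitarity
(`IsUnitaryFamily.intertwine_adjoint`, `IsUnitaryFamily.adjoint_eq_rotateLeft`).

A `*`-isomorphism is unitary, so the matrix units of the endomorphism algebra pull back to an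
orthonormal basis of `K`. In it `X` has components `X_{(a,b),(c,d)} : V → V`. That multiplication
and unit are intertwiners means `∑_b X_{(a,b),(c,d)} X_{(b,b'),(c',d')} = δ_{dc'} X_{(a,b'),(c,d')}`
and `∑_c X_{(a,b),(c,c)} = δ_ab`; with unitarity of `X` this gives `X_{(a,b),(c,d)}† =
X_{(b,a),(d,c)}`. The bent endomorphism `y` has blocks `(1/n) X_{(a,k),(c,d)}` in row `(c,a)` and
column `(d,k)`, so these relations say exactly what is needed for `y² = y = y†`.

Split `y = i i†` with `i` an isometry and let `P` be `√n` times the bent `i`. Then `P_ac P_kd† =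
X_{(a,k),(c,d)}` (`comp_unbend_comp_adjoint`), and the left-hand side is a component of `P ∘ P̄`;
hence `P ∘ P̄` and `X` have the same components. The unit and multiplication relations make `P`
unitary.

The structure maps of `Γ_X` are averages such as `(1/n) ∑ P_kj† m (P ⊗ P)_kj`. Composing with `P_ab`
produces `P_ab P_kj†`, a component of `X`, which moves past `m`; unitarity then collapses the sum,
so `P` intertwines the new structure with the old one (`IsUnitaryFamily.comp_average`). Since the
`P_ab` are jointly injective, the axioms of a quantum graph pass from `V` to `A`. If `H = 0` there
are no components, but then `A = 0`. -/

/-- The coordinate of a vector of `W ⊗ H` along the basis vector `b i` of `H`. -/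
def coordR (b : OrthonormalBasis ι ℂ H) (W : Type*) [NormedAddCommGroup W]
    [InnerProductSpace ℂ W] (i : ι) : W ⊗[ℂ] H →ₗ[ℂ] W :=
  (TensorProduct.rid ℂ W).toLinearMap ∘ₗ (b.toBasis.coord i).lTensor W

/-- The coordinate of a vector of `H ⊗ V` along the basis vector `b i` of `H`. -/
def coordL (b : OrthonormalBasis ι ℂ H) (V : Type*) [NormedAddCommGroup V]
    [InnerProductSpace ℂ V] (i : ι) : H ⊗[ℂ] V →ₗ[ℂ] V :=
  (TensorProduct.lid ℂ V).toLinearMap ∘ₗ (b.toBasis.coord i).rTensor V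

theorem coordR_tmul (b : OrthonormalBasis ι ℂ H) (i : ι) (w : W) (h : H) :
    coordR b W i (w ⊗ₜ h) = b.repr h i • w := by
  simp [coordR]

theorem coordL_tmul (b : OrthonormalBasis ι ℂ H) (i : ι) (v : V) (h : H) :
    coordL b V i (h ⊗ₜ v) = b.repr h i • v := by
  simp [coordL]

theorem coordR_basis (b : OrthonormalBasis ι ℂ H) (i j : ι) (w : W) :
    coordR b W i (w ⊗ₜ b j) = if i = j then w else 0 := by
  rw [coordR_tmul, b.repr_self]
  simp

theorem coordL_basis (b : OrthonormalBasis ι ℂ H) (i j : ι) (v : V) :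
    coordL b V i (b j ⊗ₜ v) = if i = j then v else 0 := by
  rw [coordL_tmul, b.repr_self]
  simp

theorem sum_coordR (b : OrthonormalBasis ι ℂ H) (t : W ⊗[ℂ] H) :
    ∑ i, coordR b W i t ⊗ₜ[ℂ] b i = t := by
  induction t with
  | zero => simp
  | tmul w h =>
    simp only [coordR_tmul, TensorProduct.smul_tmul]
    rw [← TensorProduct.tmul_sum, b.sum_repr]
  | add x y hx hy => simp only [map_add, TensorProduct.add_tmul, Finset.sum_add_distrib, hx, hy]

theorem sum_coordL (b : OrthonormalBasis ι ℂ H) (t : H ⊗[ℂ] V) :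
    ∑ i, b i ⊗ₜ[ℂ] coordL b V i t = t := by
  induction t with
  | zero => simp
  | tmul h v =>
    simp only [coordL_tmul, ← TensorProduct.smul_tmul]
    rw [← TensorProduct.sum_tmul, b.sum_repr]
  | add x y hx hy => simp only [map_add, TensorProduct.tmul_add, Finset.sum_add_distrib, hx, hy]

theorem ext_coordR (b : OrthonormalBasis ι ℂ H) {s t : W ⊗[ℂ] H}
    (h : ∀ i, coordR b W i s = coordR b W i t) : s = t := by
  rw [← sum_coordR b s, ← sum_coordR b t]; simp only [h]

theorem inner_tmul_basis (b : OrthonormalBasis ι ℂ H) (w : W) (i : ι) (t : W ⊗[ℂ] H) :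
    inner ℂ (w ⊗ₜ[ℂ] b i) t = inner ℂ w (coordR b W i t) := by
  induction t with
  | zero => simp
  | tmul w' h => rw [coordR_tmul, TensorProduct.inner_tmul, inner_smul_right, b.repr_apply_apply,
      mul_comm]
  | add x y hx hy => rw [inner_add_right, hx, hy, map_add, inner_add_right]

theorem inner_basis_tmul (b : OrthonormalBasis ι ℂ H) (v : V) (i : ι) (t : H ⊗[ℂ] V) :
    inner ℂ (b i ⊗ₜ[ℂ] v) t = inner ℂ v (coordL b V i t) := by
  induction t with
  | zero => simp
  | tmul h w' => rw [coordL_tmul, TensorProduct.inner_tmul, inner_smul_right, b.repr_apply_apply]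
  | add x y hx hy => rw [inner_add_right, hx, hy, map_add, inner_add_right]

/-- The components of a map `H ⊗ V → W ⊗ H`. -/
def comp (b : OrthonormalBasis ι ℂ H) (T : H ⊗[ℂ] V →ₗ[ℂ] W ⊗[ℂ] H) (i j : ι) : V →ₗ[ℂ] W :=
  coordR b W i ∘ₗ T ∘ₗ mk ℂ H V (b j)

/-- The components of a map `W ⊗ H → H ⊗ V`. -/
def compOp (b : OrthonormalBasis ι ℂ H) (T : W ⊗[ℂ] H →ₗ[ℂ] H ⊗[ℂ] V) (i j : ι) : W →ₗ[ℂ] V :=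
  coordL b V i ∘ₗ T ∘ₗ (mk ℂ W H).flip (b j)

/-- The components of a map `H ⊗ V → H ⊗ W`. -/
def compL (b : OrthonormalBasis ι ℂ H) (T : H ⊗[ℂ] V →ₗ[ℂ] H ⊗[ℂ] W) (i j : ι) : V →ₗ[ℂ] W :=
  coordL b W i ∘ₗ T ∘ₗ mk ℂ H V (b j)

theorem apply_basis_tmul (b : OrthonormalBasis ι ℂ H) (T : H ⊗[ℂ] V →ₗ[ℂ] W ⊗[ℂ] H) (j : ι)
    (v : V) : T (b j ⊗ₜ v) = ∑ i, comp b T i j v ⊗ₜ[ℂ] b i :=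
  (sum_coordR b _).symm

theorem apply_tmul_basis (b : OrthonormalBasis ι ℂ H) (T : W ⊗[ℂ] H →ₗ[ℂ] H ⊗[ℂ] V) (j : ι)
    (w : W) : T (w ⊗ₜ b j) = ∑ i, b i ⊗ₜ[ℂ] compOp b T i j w :=
  (sum_coordL b _).symm

theorem comp_eq_of_apply (b : OrthonormalBasis ι ℂ H) {T : H ⊗[ℂ] V →ₗ[ℂ] W ⊗[ℂ] H}
    {F : ι → ι → V →ₗ[ℂ] W} (h : ∀ j v, T (b j ⊗ₜ v) = ∑ i, F i j v ⊗ₜ[ℂ] b i) (i j : ι) :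
    comp b T i j = F i j := by
  ext v
  simp [comp, h, coordR_basis]

theorem linearMap_ext_basis_left (b : OrthonormalBasis ι ℂ H) {M : Type*} [AddCommMonoid M]
    [Module ℂ M] {S T : H ⊗[ℂ] V →ₗ[ℂ] M} (h : ∀ j v, S (b j ⊗ₜ v) = T (b j ⊗ₜ v)) : S = T := by
  apply LinearMap.ext fun t => ?_
  rw [← sum_coordL b t]
  simp [h]

theorem linearMap_ext_basis_right (b : OrthonormalBasis ι ℂ H) {M : Type*} [AddCommMonoid M]
    [Module ℂ M] {S T : W ⊗[ℂ] H →ₗ[ℂ] M} (h : ∀ j w, S (w ⊗ₜ b j) = T (w ⊗ₜ b j)) : S = T := by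
  apply LinearMap.ext fun t => ?_
  rw [← sum_coordR b t]
  simp [h]

theorem ext_comp (b : OrthonormalBasis ι ℂ H) {S T : H ⊗[ℂ] V →ₗ[ℂ] W ⊗[ℂ] H} :
    S = T ↔ ∀ i j, comp b S i j = comp b T i j :=
  ⟨fun h _ _ => by rw [h], fun h => linearMap_ext_basis_left b fun j v => by
    simp only [apply_basis_tmul, h]⟩

theorem ext_compOp (b : OrthonormalBasis ι ℂ H) {S T : W ⊗[ℂ] H →ₗ[ℂ] H ⊗[ℂ] V} :
    S = T ↔ ∀ i j, compOp b S i j = compOp b T i j :=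
  ⟨fun h _ _ => by rw [h], fun h => linearMap_ext_basis_right b fun j v => by
    simp only [apply_tmul_basis, h]⟩

theorem comp_rTensor_comp (b : OrthonormalBasis ι ℂ H) (f : W →ₗ[ℂ] Z)
    (T : H ⊗[ℂ] V →ₗ[ℂ] W ⊗[ℂ] H) (i j : ι) :
    comp b (f.rTensor H ∘ₗ T) i j = f ∘ₗ comp b T i j :=
  comp_eq_of_apply b (F := fun i j => f ∘ₗ comp b T i j)
    (fun j v => by simp [apply_basis_tmul b T]) i j

theorem comp_comp_lTensor (b : OrthonormalBasis ι ℂ H) (f : Z →ₗ[ℂ] V)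
    (T : H ⊗[ℂ] V →ₗ[ℂ] W ⊗[ℂ] H) (i j : ι) :
    comp b (T ∘ₗ f.lTensor H) i j = comp b T i j ∘ₗ f :=
  comp_eq_of_apply b (F := fun i j => comp b T i j ∘ₗ f)
    (fun j v => by simp [apply_basis_tmul b T]) i j

/-- The `H`-wire enters with index `j`, has index `k` after crossing the first algebra wire, and
leaves with index `i` after the second. Hence the first tensor factor carries the right-hand matrix
entry. -/
theorem comp_pullTwo (b : OrthonormalBasis ι ℂ H) (P : H ⊗[ℂ] V →ₗ[ℂ] W ⊗[ℂ] H) (i j : ι) :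
    comp b (pullTwo P) i j = ∑ k, TensorProduct.map (comp b P k j) (comp b P i k) := by
  refine TensorProduct.ext' fun v w => ?_
  change coordR b (W ⊗[ℂ] W) i (pullTwo P (b j ⊗ₜ (v ⊗ₜ w))) = _
  simp [pullTwo, apply_basis_tmul b P, TensorProduct.sum_tmul, TensorProduct.tmul_sum,
    coordR_basis]

theorem comp_pullZero (b : OrthonormalBasis ι ℂ H) (i j : ι) :
    comp b (pullZero H) i j = if i = j then LinearMap.id else 0 := by
  ext
  split_ifs with h <;> simp [comp, pullZero, coordR_basis, h]

theorem compOp_adjoint [FiniteDimensional ℂ V] [FiniteDimensional ℂ W] [FiniteDimensional ℂ H]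
    (b : OrthonormalBasis ι ℂ H) (P : H ⊗[ℂ] V →ₗ[ℂ] W ⊗[ℂ] H) (i j : ι) :
    compOp b (LinearMap.adjoint P) i j = LinearMap.adjoint (comp b P j i) := by
  rw [LinearMap.eq_adjoint_iff]
  intro w v
  rw [← inner_conj_symm, compOp, LinearMap.comp_apply, ← inner_basis_tmul]
  rw [LinearMap.comp_apply, LinearMap.adjoint_inner_right, inner_conj_symm]
  exact inner_tmul_basis b w j _

theorem compL_adjoint_comp [FiniteDimensional ℂ V] [FiniteDimensional ℂ W]
    [FiniteDimensional ℂ H]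
    (b : OrthonormalBasis ι ℂ H) (P : H ⊗[ℂ] V →ₗ[ℂ] W ⊗[ℂ] H) (S : H ⊗[ℂ] Z →ₗ[ℂ] W ⊗[ℂ] H)
    (i j : ι) :
    compL b (LinearMap.adjoint P ∘ₗ S) i j =
      ∑ k, LinearMap.adjoint (comp b P k i) ∘ₗ comp b S k j := by
  ext z
  simp [compL, apply_basis_tmul b S, apply_tmul_basis b (LinearMap.adjoint P), compOp_adjoint,
    coordL_basis]

/-- Bending the algebra wires of `f : V → W` with the Frobenius cup of `V` and cap of `W`:
`w ↦ (cap_W ⊗ id_V) (w ⊗ (f ⊗ id_V) cup_V)`. -/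
def rotateLeft (M : AlgData V) (N : AlgData W) [FiniteDimensional ℂ V] [FiniteDimensional ℂ W]
    (f : V →ₗ[ℂ] W) : W →ₗ[ℂ] V :=
  (TensorProduct.lid ℂ V).toLinearMap ∘ₗ N.frobCap.rTensor V ∘ₗ
    (TensorProduct.assoc ℂ W W V).symm.toLinearMap ∘ₗ
    (mk ℂ W (W ⊗[ℂ] V)).flip (f.rTensor V (M.frobCup 1))

/-- Only algebra wires are bent, so the indices of the `H`-wire stay in place, whereas the adjoint
transposes them (`compOp_adjoint`). Thus `P† = rotateAlg P` reads `(P_ji)† = rotateLeft P_ij`. -/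
theorem compOp_rotateAlg [FiniteDimensional ℂ V] [FiniteDimensional ℂ W] [FiniteDimensional ℂ H]
    (b : OrthonormalBasis ι ℂ H) (M : AlgData V) (N : AlgData W)
    (P : H ⊗[ℂ] V →ₗ[ℂ] W ⊗[ℂ] H) (i j : ι) :
    compOp b (rotateAlg M N P) i j = rotateLeft M N (comp b P i j) := by
  ext w
  simp only [compOp, rotateAlg, rotateLeft, LinearMap.comp_apply, LinearMap.flip_apply,
    TensorProduct.mk_apply, LinearMap.lTensor_tmul, LinearEquiv.coe_coe,
    TensorProduct.rid_symm_apply]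
  generalize M.frobCup 1 = t
  induction t with
  | zero => simp
  | add x y hx hy => simp only [TensorProduct.tmul_add, map_add, hx, hy]
  | tmul x y =>
    simp [apply_basis_tmul b P, TensorProduct.sum_tmul, TensorProduct.tmul_sum,
      coordL_tmul]

theorem comp_compMap (b : OrthonormalBasis ι ℂ H) (c : OrthonormalBasis κ ℂ K)
    (Q : K ⊗[ℂ] W →ₗ[ℂ] Z ⊗[ℂ] K) (P : H ⊗[ℂ] V →ₗ[ℂ] W ⊗[ℂ] H) (x y : κ × ι) :
    comp (c.tensorProduct b) (compMap Q P) x y = comp c Q x.1 y.1 ∘ₗ comp b P x.2 y.2 := by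
  refine comp_eq_of_apply (c.tensorProduct b)
    (F := fun x y => comp c Q x.1 y.1 ∘ₗ comp b P x.2 y.2) (fun y v => ?_) x y
  obtain ⟨k, j⟩ := y
  simp [compMap, OrthonormalBasis.tensorProduct_apply, apply_basis_tmul b P,
    apply_basis_tmul c Q, TensorProduct.tmul_sum, TensorProduct.sum_tmul,
    Fintype.sum_prod_type_right]

theorem isIntertwiner_iff (b : OrthonormalBasis ι ℂ H) (c : OrthonormalBasis κ ℂ K)
    (P : H ⊗[ℂ] V →ₗ[ℂ] W ⊗[ℂ] H) (Q : K ⊗[ℂ] V →ₗ[ℂ] W ⊗[ℂ] K) (f : H →ₗ[ℂ] K) :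
    IsIntertwiner P Q f ↔ ∀ i j,
      ∑ k, c.repr (f (b j)) k • comp c Q i k = ∑ k, c.repr (f (b k)) i • comp b P k j := by
  have h1 : ∀ i j v, coordR c W i (Q (f (b j) ⊗ₜ v)) =
      (∑ k, c.repr (f (b j)) k • comp c Q i k) v := by
    intro i j v
    conv_lhs => rw [← c.sum_repr (f (b j))]
    simp [TensorProduct.sum_tmul, ← TensorProduct.smul_tmul', comp]
  have h2 : ∀ i j v, coordR c W i (f.lTensor W (P (b j ⊗ₜ v))) =
      (∑ k, c.repr (f (b k)) i • comp b P k j) v := by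
    intro i j v
    simp [apply_basis_tmul b P, coordR_tmul]
  constructor
  · intro h i j
    ext v
    rw [← h1, ← h2]
    exact congrArg _ (LinearMap.congr_fun h (b j ⊗ₜ v))
  · intro h
    refine linearMap_ext_basis_left b fun j v => ext_coordR c fun i => ?_
    have := LinearMap.congr_fun (h i j) v
    rw [← h1, ← h2] at this
    exact this

end Components

/-! ### Dagger Frobenius algebras: counitality and the snake equations -/

section Frobenius

variable {A : Type*} [NormedAddCommGroup A] [InnerProductSpace ℂ A] [FiniteDimensional ℂ A]

namespace AlgData.IsDaggerFrobenius

variable {M : AlgData A}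

theorem assoc_apply (hM : M.IsDaggerFrobenius) (x y z : A) :
    M.mul (M.mul (x ⊗ₜ y) ⊗ₜ z) = M.mul (x ⊗ₜ M.mul (y ⊗ₜ z)) := by
  simpa using LinearMap.congr_fun hM.mul_assoc ((x ⊗ₜ y) ⊗ₜ z)

theorem one_mul_apply (hM : M.IsDaggerFrobenius) (x : A) : M.mul (M.unit 1 ⊗ₜ x) = x := by
  simpa using LinearMap.congr_fun hM.unit_mul (1 ⊗ₜ x)

theorem mul_one_apply (hM : M.IsDaggerFrobenius) (x : A) : M.mul (x ⊗ₜ M.unit 1) = x := by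
  simpa using LinearMap.congr_fun hM.mul_unit (x ⊗ₜ 1)

theorem lid_counit_comul (hM : M.IsDaggerFrobenius) (x : A) :
    TensorProduct.lid ℂ A (M.counit.rTensor A (M.comul x)) = x := by
  have h := congrArg LinearMap.adjoint hM.unit_mul
  rw [LinearMap.adjoint_comp, LinearMap.adjoint_rTensor] at h
  have h2 : LinearMap.adjoint (TensorProduct.lid ℂ A).toLinearMap =
      (TensorProduct.lid ℂ A).symm.toLinearMap :=
    LinearIsometryEquiv.adjoint_toLinearMap_eq_symm (TensorProduct.lidIsometry ℂ A)
  rw [h2] at h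
  have h3 := LinearMap.congr_fun h x
  rw [LinearMap.comp_apply] at h3
  exact (LinearEquiv.eq_symm_apply _).1 h3

theorem rid_counit_comul (hM : M.IsDaggerFrobenius) (x : A) :
    TensorProduct.rid ℂ A (M.counit.lTensor A (M.comul x)) = x := by
  have h := congrArg LinearMap.adjoint hM.mul_unit
  rw [LinearMap.adjoint_comp, LinearMap.adjoint_lTensor] at h
  have h2 : LinearMap.adjoint (TensorProduct.rid ℂ A).toLinearMap =
      (TensorProduct.rid ℂ A).symm.toLinearMap :=
    LinearIsometryEquiv.adjoint_toLinearMap_eq_symm (TensorProduct.ridIsometry ℂ A)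
  rw [h2] at h
  have h3 := LinearMap.congr_fun h x
  rw [LinearMap.comp_apply] at h3
  exact (LinearEquiv.eq_symm_apply _).1 h3

/-- The Frobenius equation applied to `x ⊗ u` turns the zigzag into `(u† ⊗ 1) m† (x · 1)`, and
counitality, the adjoint of the unit law, finishes. -/
theorem snake_left (hM : M.IsDaggerFrobenius) (x : A) :
    TensorProduct.lid ℂ A (M.frobCap.rTensor A
      ((TensorProduct.assoc ℂ A A A).symm (x ⊗ₜ M.frobCup 1))) = x := by
  have h := LinearMap.congr_fun hM.frobenius_left (x ⊗ₜ M.unit 1)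
  simp only [LinearMap.comp_apply, LinearMap.lTensor_tmul, LinearEquiv.coe_coe,
    hM.mul_one_apply] at h
  rw [AlgData.frobCap, LinearMap.rTensor_comp, LinearMap.comp_apply, AlgData.frobCup,
    LinearMap.comp_apply, h, hM.lid_counit_comul]

theorem snake_right (hM : M.IsDaggerFrobenius) (x : A) :
    TensorProduct.rid ℂ A (M.frobCap.lTensor A
      (TensorProduct.assoc ℂ A A A (M.frobCup 1 ⊗ₜ x))) = x := by
  have h := LinearMap.congr_fun hM.frobenius_right (M.unit 1 ⊗ₜ x)
  simp only [LinearMap.comp_apply, LinearMap.rTensor_tmul, LinearEquiv.coe_coe,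
    hM.one_mul_apply] at h
  rw [AlgData.frobCap, LinearMap.lTensor_comp, LinearMap.comp_apply, AlgData.frobCup,
    LinearMap.comp_apply, h, hM.rid_counit_comul]

end AlgData.IsDaggerFrobenius

end Frobenius

/-! ### Unitary families -/

section Families

variable {ι V W Z A B : Type*} [Fintype ι] [DecidableEq ι]
  [NormedAddCommGroup V] [InnerProductSpace ℂ V] [FiniteDimensional ℂ V]
  [NormedAddCommGroup W] [InnerProductSpace ℂ W] [FiniteDimensional ℂ W]
  [NormedAddCommGroup A] [InnerProductSpace ℂ A] [FiniteDimensional ℂ A]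
  [NormedAddCommGroup B] [InnerProductSpace ℂ B] [FiniteDimensional ℂ B]

/-- The components of `pullTwo P` in terms of the components of `P`. -/
def pairFamily (F : ι → ι → V →ₗ[ℂ] W) (i j : ι) : V ⊗[ℂ] V →ₗ[ℂ] W ⊗[ℂ] W :=
  ∑ k, TensorProduct.map (F k j) (F i k)

/-- A square matrix of linear maps `V → W` that is unitary. -/
structure IsUnitaryFamily (F : ι → ι → V →ₗ[ℂ] W) : Prop where
  adjoint_comp : ∀ j k, ∑ i, LinearMap.adjoint (F i j) ∘ₗ F i k =
    if j = k then LinearMap.id else 0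
  comp_adjoint : ∀ i k, ∑ j, F i j ∘ₗ LinearMap.adjoint (F k j) =
    if i = k then LinearMap.id else 0

theorem adjoint_pairFamily (F : ι → ι → V →ₗ[ℂ] W) (i j : ι) :
    LinearMap.adjoint (pairFamily F i j) =
      ∑ k, TensorProduct.map (LinearMap.adjoint (F k j)) (LinearMap.adjoint (F i k)) := by
  simp [pairFamily, map_sum]

theorem sum_comp_linear {κ : Type*} [Fintype κ] (f : κ → V →ₗ[ℂ] W) (g : A →ₗ[ℂ] V) :
    (∑ k, f k) ∘ₗ g = ∑ k, f k ∘ₗ g := by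
  ext; simp

theorem comp_sum_linear {κ : Type*} [Fintype κ] (f : V →ₗ[ℂ] W) (g : κ → A →ₗ[ℂ] V) :
    f ∘ₗ ∑ k, g k = ∑ k, f ∘ₗ g k := by
  ext; simp

theorem tensorMap_sum_left {κ : Type*} [Fintype κ] (f : κ → V →ₗ[ℂ] W) (g : A →ₗ[ℂ] B) :
    TensorProduct.map (∑ k, f k) g = ∑ k, TensorProduct.map (f k) g :=
  map_sum ((TensorProduct.mapBilinear (RingHom.id ℂ) V A W B).flip g) f Finset.univ

theorem tensorMap_sum_right {κ : Type*} [Fintype κ] (f : A →ₗ[ℂ] B) (g : κ → V →ₗ[ℂ] W) :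
    TensorProduct.map f (∑ k, g k) = ∑ k, TensorProduct.map f (g k) :=
  map_sum (TensorProduct.mapBilinear (RingHom.id ℂ) A V B W f) g Finset.univ

/-- One tensor factor is summed first: unitarity there forces the two inner indices to agree and
leaves an identity, after which unitarity applies to the other factor. -/
theorem IsUnitaryFamily.pair {F : ι → ι → V →ₗ[ℂ] W} (hF : IsUnitaryFamily F) :
    IsUnitaryFamily (pairFamily F) where
  adjoint_comp j m := by
    simp only [adjoint_pairFamily]
    simp only [pairFamily, sum_comp_linear, comp_sum_linear,
      ← TensorProduct.map_comp]
    rw [Finset.sum_comm]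
    have : ∀ l, ∑ i, ∑ k, TensorProduct.map (LinearMap.adjoint (F k j) ∘ₗ F l m)
        (LinearMap.adjoint (F i k) ∘ₗ F i l) =
        TensorProduct.map (LinearMap.adjoint (F l j) ∘ₗ F l m) LinearMap.id := by
      intro l
      rw [Finset.sum_comm]
      simp only [← tensorMap_sum_right, hF.adjoint_comp]
      rw [Finset.sum_eq_single l] <;> simp +contextual
    simp only [this, ← tensorMap_sum_left, hF.adjoint_comp]
    split_ifs <;> simp
  comp_adjoint i m := by
    simp only [adjoint_pairFamily]
    simp only [pairFamily, sum_comp_linear, comp_sum_linear,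
      ← TensorProduct.map_comp]
    have : ∀ l, ∑ j, ∑ k, TensorProduct.map (F k j ∘ₗ LinearMap.adjoint (F l j))
        (F i k ∘ₗ LinearMap.adjoint (F m l)) =
        TensorProduct.map LinearMap.id (F i l ∘ₗ LinearMap.adjoint (F m l)) := by
      intro l
      rw [Finset.sum_comm]
      simp only [← tensorMap_sum_left, hF.comp_adjoint]
      rw [Finset.sum_eq_single l] <;> simp +contextual
    rw [Finset.sum_comm]
    simp only [this, ← tensorMap_sum_right, hF.comp_adjoint]
    split_ifs <;> simp

/-- These are the components of `pullZero`. They let units be treated as intertwiners between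
unitary families, on the same footing as multiplications. -/
theorem isUnitaryFamily_scalar :
    IsUnitaryFamily (fun i j : ι => if i = j then (LinearMap.id : ℂ →ₗ[ℂ] ℂ) else 0) where
  adjoint_comp j k := by
    rw [Finset.sum_eq_single j] <;> simp +contextual
  comp_adjoint j k := by
    rw [Finset.sum_eq_single j]
    · by_cases h : j = k
      · subst h; simp
      · simp [h, Ne.symm h]
    · intro i _ hi
      rw [if_neg hi.symm, LinearMap.zero_comp]
    · simp

/-- Taking adjoints of `G T = S F` gives `T† G† = F† S†`; multiplying by `F` on the left and by `G`
on the right, and cancelling by unitarity, leaves `F T† = S† G`. -/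
theorem IsUnitaryFamily.intertwine_adjoint {F : ι → ι → A →ₗ[ℂ] V} {G : ι → ι → B →ₗ[ℂ] W}
    (hF : IsUnitaryFamily F) (hG : IsUnitaryFamily G) {T : A →ₗ[ℂ] B} {S : V →ₗ[ℂ] W}
    (h : ∀ i j, G i j ∘ₗ T = S ∘ₗ F i j) (i j : ι) :
    F i j ∘ₗ LinearMap.adjoint T = LinearMap.adjoint S ∘ₗ G i j := by
  have h' : ∀ i j, LinearMap.adjoint T ∘ₗ LinearMap.adjoint (G i j) =
      LinearMap.adjoint (F i j) ∘ₗ LinearMap.adjoint S := fun i j => by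
    rw [← LinearMap.adjoint_comp, h, LinearMap.adjoint_comp]
  calc F i j ∘ₗ LinearMap.adjoint T
      = ∑ c, F i c ∘ₗ LinearMap.adjoint T ∘ₗ ∑ d, LinearMap.adjoint (G d c) ∘ₗ G d j := by
        simp only [hG.adjoint_comp]
        rw [Finset.sum_eq_single j] <;> simp +contextual
    _ = ∑ d, (∑ c, F i c ∘ₗ LinearMap.adjoint (F d c)) ∘ₗ LinearMap.adjoint S ∘ₗ G d j := by
        simp only [comp_sum_linear, sum_comp_linear]
        rw [Finset.sum_comm]
        refine Finset.sum_congr rfl fun d _ => Finset.sum_congr rfl fun c _ => ?_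
        exact congrArg (fun f => F i c ∘ₗ f ∘ₗ G d j) (h' d c)
    _ = _ := by
        simp only [hF.comp_adjoint]
        rw [Finset.sum_eq_single i] <;> simp +contextual [eq_comm]

/-- Summing over `i` assembles `∑_i F_ik ⊗ F_ji`, the `(j,k)` entry of the pair family, under the
cap of `N`. Compatibility with multiplication and counit replaces this by `δ_jk` times the cap of
`M`, and the snake equation remains. -/
theorem sum_rotateLeft_comp {M : AlgData V} {N : AlgData W} (hM : M.IsDaggerFrobenius)
    {F : ι → ι → V →ₗ[ℂ] W} (hmul : ∀ i j, F i j ∘ₗ M.mul = N.mul ∘ₗ pairFamily F i j)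
    (hcounit : ∀ i j, N.counit ∘ₗ F i j = if i = j then M.counit else 0) (j k : ι) :
    ∑ i, rotateLeft M N (F j i) ∘ₗ F i k = if j = k then LinearMap.id else 0 := by
  have key : ∀ (v : V) (t : V ⊗[ℂ] V),
      ∑ i, TensorProduct.lid ℂ V (N.frobCap.rTensor V ((TensorProduct.assoc ℂ W W V).symm
        (F i k v ⊗ₜ (F j i).rTensor V t))) =
      if j = k then TensorProduct.lid ℂ V (M.frobCap.rTensor V
        ((TensorProduct.assoc ℂ V V V).symm (v ⊗ₜ t))) else 0 := by
    intro v t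
    induction t with
    | zero => simp
    | add x y hx hy =>
      simp only [map_add, TensorProduct.tmul_add, Finset.sum_add_distrib, hx, hy]
      split_ifs <;> simp
    | tmul x y =>
      have h1 := LinearMap.congr_fun (hmul j k) (v ⊗ₜ x)
      have h2 := LinearMap.congr_fun (hcounit j k) (M.mul (v ⊗ₜ x))
      simp only [LinearMap.comp_apply, pairFamily, LinearMap.sum_apply, TensorProduct.map_tmul]
        at h1 h2
      rw [h1] at h2
      simp only [LinearMap.rTensor_tmul, TensorProduct.assoc_symm_tmul, TensorProduct.lid_tmul,
        AlgData.frobCap, LinearMap.comp_apply, ← Finset.sum_smul, ← map_sum, h2]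
      split_ifs <;> simp
  refine LinearMap.ext fun v => ?_
  have := key v (M.frobCup 1)
  rw [hM.snake_left] at this
  rw [LinearMap.sum_apply]
  refine this.trans ?_
  split_ifs <;> rfl

end Families

/-! ### Quantum isomorphisms in components -/

section Isomorphisms

variable {ι V W A H : Type*} [Fintype ι] [DecidableEq ι]
  [NormedAddCommGroup V] [InnerProductSpace ℂ V] [FiniteDimensional ℂ V]
  [NormedAddCommGroup W] [InnerProductSpace ℂ W] [FiniteDimensional ℂ W]
  [NormedAddCommGroup A] [InnerProductSpace ℂ A] [FiniteDimensional ℂ A]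
  [NormedAddCommGroup H] [InnerProductSpace ℂ H] [FiniteDimensional ℂ H]

theorem comp_pullTwo_eq_pairFamily (b : OrthonormalBasis ι ℂ H) (P : H ⊗[ℂ] V →ₗ[ℂ] W ⊗[ℂ] H)
    (i j : ι) : comp b (pullTwo P) i j = pairFamily (comp b P) i j :=
  comp_pullTwo b P i j

theorem IsUnitaryFamily.of_adjoint_comp {F : ι → ι → V →ₗ[ℂ] V}
    (h : ∀ j k, ∑ i, LinearMap.adjoint (F i j) ∘ₗ F i k = if j = k then LinearMap.id else 0) :
    IsUnitaryFamily F where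
  adjoint_comp := h
  comp_adjoint i k := by
    have h1 : (Matrix.of fun j i => LinearMap.adjoint (F i j) : Matrix ι ι (Module.End ℂ V)) *
        Matrix.of F = 1 := by
      ext1 j k
      rw [Matrix.mul_apply, Matrix.one_apply]
      exact h j k
    -- In matrices over `End V`, with `V` finite-dimensional, a one-sided inverse is two-sided. This
    -- is why source and target are the same space here.
    have h3 := mul_eq_one_comm.1 h1
    have h2 := congrFun (congrFun h3 i) k
    rw [Matrix.mul_apply, Matrix.one_apply] at h2
    exact h2

namespace QuantumIso

theorem comp_mul {Γ : QuantumGraph V} {Γ' : QuantumGraph W} (P : QuantumIso Γ Γ' H)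
    (b : OrthonormalBasis ι ℂ H) (i j : ι) :
    comp b P.map i j ∘ₗ Γ.alg.mul = Γ'.alg.mul ∘ₗ pairFamily (comp b P.map) i j := by
  rw [← comp_comp_lTensor, P.map_mul, comp_rTensor_comp, comp_pullTwo_eq_pairFamily]

theorem comp_unit {Γ : QuantumGraph V} {Γ' : QuantumGraph W} (P : QuantumIso Γ Γ' H)
    (b : OrthonormalBasis ι ℂ H) (i j : ι) :
    comp b P.map i j ∘ₗ Γ.alg.unit = if i = j then Γ'.alg.unit else 0 := by
  rw [← comp_comp_lTensor, P.map_unit, comp_rTensor_comp, comp_pullZero]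
  split_ifs <;> simp

theorem counit_comp {Γ : QuantumGraph V} {Γ' : QuantumGraph W} (P : QuantumIso Γ Γ' H)
    (b : OrthonormalBasis ι ℂ H) (i j : ι) :
    Γ'.alg.counit ∘ₗ comp b P.map i j = if i = j then Γ.alg.counit else 0 := by
  rw [← comp_rTensor_comp, P.map_counit, comp_comp_lTensor, comp_pullZero]
  split_ifs <;> simp

theorem comp_adj {Γ : QuantumGraph V} {Γ' : QuantumGraph W} (P : QuantumIso Γ Γ' H)
    (b : OrthonormalBasis ι ℂ H) (i j : ι) :
    comp b P.map i j ∘ₗ Γ.adj = Γ'.adj ∘ₗ comp b P.map i j := by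
  rw [← comp_comp_lTensor, P.map_adj, comp_rTensor_comp]

/-- The axiom on `P†` identifies the adjoint family with the rotated one, which is a left inverse by
the snake equation. -/
theorem isUnitaryFamily_comp {Γ Γ' : QuantumGraph V} (P : QuantumIso Γ Γ' H)
    (b : OrthonormalBasis ι ℂ H) : IsUnitaryFamily (comp b P.map) := by
  refine IsUnitaryFamily.of_adjoint_comp fun j k => ?_
  rw [← sum_rotateLeft_comp Γ.frobenius (P.comp_mul b) (P.counit_comp b) j k]
  refine Finset.sum_congr rfl fun i _ => ?_
  rw [← compOp_adjoint, P.adjoint_eq, compOp_rotateAlg]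

end QuantumIso

theorem IsUnitaryFamily.counit_comp {M : AlgData V} {N : AlgData W} {F : ι → ι → V →ₗ[ℂ] W}
    (hF : IsUnitaryFamily F) (hunit : ∀ i j, F i j ∘ₗ M.unit = if i = j then N.unit else 0)
    (i j : ι) : N.counit ∘ₗ F i j = if i = j then M.counit else 0 := by
  have h := isUnitaryFamily_scalar.intertwine_adjoint hF (T := M.unit) (S := N.unit)
    (fun i j => by rw [hunit]; split_ifs <;> simp) i j
  rw [AlgData.counit, ← h]
  split_ifs <;> simp [AlgData.counit]

theorem IsUnitaryFamily.comul_comp {M : AlgData V} {N : AlgData W} {F : ι → ι → V →ₗ[ℂ] W}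
    (hF : IsUnitaryFamily F) (hmul : ∀ i j, F i j ∘ₗ M.mul = N.mul ∘ₗ pairFamily F i j)
    (i j : ι) : N.comul ∘ₗ F i j = pairFamily F i j ∘ₗ M.comul :=
  (hF.pair.intertwine_adjoint hF hmul i j).symm

/-- The rotated family is a left inverse of `F` and the adjoint family is a two-sided inverse, so
the two agree. -/
theorem IsUnitaryFamily.adjoint_eq_rotateLeft {M : AlgData V} {N : AlgData W}
    (hM : M.IsDaggerFrobenius) {F : ι → ι → V →ₗ[ℂ] W} (hF : IsUnitaryFamily F)
    (hmul : ∀ i j, F i j ∘ₗ M.mul = N.mul ∘ₗ pairFamily F i j)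
    (hunit : ∀ i j, F i j ∘ₗ M.unit = if i = j then N.unit else 0) (i j : ι) :
    LinearMap.adjoint (F j i) = rotateLeft M N (F i j) := by
  have h := sum_rotateLeft_comp hM hmul (hF.counit_comp hunit) i
  calc LinearMap.adjoint (F j i)
      = ∑ k, (∑ l, rotateLeft M N (F i l) ∘ₗ F l k) ∘ₗ LinearMap.adjoint (F j k) := by
        simp only [h]
        rw [Finset.sum_eq_single i] <;> simp +contextual [eq_comm]
    _ = ∑ l, rotateLeft M N (F i l) ∘ₗ ∑ k, F l k ∘ₗ LinearMap.adjoint (F j k) := by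
        simp only [sum_comp_linear, comp_sum_linear, LinearMap.comp_assoc]
        rw [Finset.sum_comm]
    _ = rotateLeft M N (F i j) := by
        simp only [hF.comp_adjoint]
        rw [Finset.sum_eq_single j] <;> simp +contextual

/-- A map with unitary matrix of components that is compatible with multiplications, units and
adjacency matrices is a quantum isomorphism. -/
def QuantumIso.ofUnitaryFamily {Γ : QuantumGraph V} {Γ' : QuantumGraph W}
    (b : OrthonormalBasis ι ℂ H) (P : H ⊗[ℂ] V →ₗ[ℂ] W ⊗[ℂ] H)
    (hP : IsUnitaryFamily (comp b P))
    (hmul : ∀ i j, comp b P i j ∘ₗ Γ.alg.mul = Γ'.alg.mul ∘ₗ pairFamily (comp b P) i j)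
    (hunit : ∀ i j, comp b P i j ∘ₗ Γ.alg.unit = if i = j then Γ'.alg.unit else 0)
    (hadj : ∀ i j, comp b P i j ∘ₗ Γ.adj = Γ'.adj ∘ₗ comp b P i j) : QuantumIso Γ Γ' H where
  map := P
  map_comul := (ext_comp b).2 fun i j => by
    rw [comp_rTensor_comp, hP.comul_comp hmul, comp_comp_lTensor, comp_pullTwo_eq_pairFamily]
  map_counit := (ext_comp b).2 fun i j => by
    rw [comp_rTensor_comp, hP.counit_comp hunit, comp_comp_lTensor, comp_pullZero]
    split_ifs <;> simp
  adjoint_eq := (ext_compOp b).2 fun i j => by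
    rw [compOp_adjoint, compOp_rotateAlg, hP.adjoint_eq_rotateLeft Γ.frobenius hmul hunit]
  map_mul := (ext_comp b).2 fun i j => by
    rw [comp_comp_lTensor, comp_rTensor_comp, hmul, comp_pullTwo_eq_pairFamily]
  map_unit := (ext_comp b).2 fun i j => by
    rw [comp_rTensor_comp, comp_comp_lTensor, hunit, comp_pullZero]
    split_ifs <;> simp
  map_adj := (ext_comp b).2 fun i j => by
    rw [comp_rTensor_comp, comp_comp_lTensor, hadj]

end Isomorphisms

/-! ### Transporting a quantum graph along a unitary family -/

section Transport

variable {ι V W A : Type*} [Fintype ι] [DecidableEq ι]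
  [NormedAddCommGroup V] [InnerProductSpace ℂ V] [FiniteDimensional ℂ V]
  [NormedAddCommGroup W] [InnerProductSpace ℂ W] [FiniteDimensional ℂ W]
  [NormedAddCommGroup A] [InnerProductSpace ℂ A] [FiniteDimensional ℂ A]

/-- For any fixed `j`, `∑_i F_ij† F_ij = 1`, so the `F_ij` are jointly injective. Every axiom on `A`
is tested through this. With no indices the hypothesis `h` is empty, and `h0` takes over. -/
theorem IsUnitaryFamily.eq_of_comp_eq {F : ι → ι → A →ₗ[ℂ] V} (hF : IsUnitaryFamily F)
    (h0 : IsEmpty ι → Subsingleton A) {M : Type*} [AddCommMonoid M] [Module ℂ M]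
    {S T : M →ₗ[ℂ] A} (h : ∀ i j, F i j ∘ₗ S = F i j ∘ₗ T) : S = T := by
  rcases isEmpty_or_nonempty ι with hι | ⟨⟨j⟩⟩
  · have := h0 hι
    ext x
    exact Subsingleton.elim _ _
  · have key : ∀ x, x = ∑ i, LinearMap.adjoint (F i j) (F i j x) := fun x => by
      have := LinearMap.congr_fun (hF.adjoint_comp j j) x
      simpa using this.symm
    ext x
    rw [key (S x), key (T x)]
    exact Finset.sum_congr rfl fun i _ => congrArg _ (LinearMap.congr_fun (h i j) x)

theorem subsingleton_tensor [Subsingleton A] : Subsingleton (A ⊗[ℂ] A) :=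
  ⟨fun s t => by
    have : ∀ s : A ⊗[ℂ] A, s = 0 := fun s => by
      induction s with
      | zero => rfl
      | tmul x y => rw [Subsingleton.elim x 0, TensorProduct.zero_tmul]
      | add x y hx hy => rw [hx, hy, add_zero]
    rw [this s, this t]⟩

namespace AlgData.IsDaggerFrobenius

variable {M : AlgData A}

/-- The Frobenius transpose is the transpose for the bilinear form `frobCap`; `frobTranspose_eq` is
the converse. Each uses one of the two snake equations. -/
theorem frobCap_frobTranspose (hM : M.IsDaggerFrobenius) (f : A →ₗ[ℂ] A) (x y : A) :
    M.frobCap (x ⊗ₜ frobTranspose M M f y) = M.frobCap (f x ⊗ₜ y) := by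
  have key : ∀ t : A ⊗[ℂ] A,
      M.frobCap (x ⊗ₜ TensorProduct.rid ℂ A ((M.frobCap ∘ₗ f.rTensor A).lTensor A
        (TensorProduct.assoc ℂ A A A (t ⊗ₜ y)))) =
      M.frobCap (f (TensorProduct.lid ℂ A (M.frobCap.rTensor A
        ((TensorProduct.assoc ℂ A A A).symm (x ⊗ₜ t)))) ⊗ₜ y) := by
    intro t
    induction t with
    | zero => simp
    | add s t hs ht =>
      simp only [map_add, TensorProduct.tmul_add, TensorProduct.add_tmul, hs, ht]
    | tmul s r =>
      simp [← TensorProduct.smul_tmul', mul_comm]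
  have := key (M.frobCup 1)
  rw [hM.snake_left] at this
  simpa [frobTranspose] using this

theorem frobTranspose_eq (hM : M.IsDaggerFrobenius) {f g : A →ₗ[ℂ] A}
    (h : ∀ x y, M.frobCap (f x ⊗ₜ y) = M.frobCap (x ⊗ₜ g y)) : frobTranspose M M f = g := by
  ext y
  have h' : M.frobCap ∘ₗ f.rTensor A = M.frobCap ∘ₗ g.lTensor A :=
    TensorProduct.ext' fun x y => by simpa using h x y
  have key : ∀ t : A ⊗[ℂ] A, (g.lTensor A).lTensor A (TensorProduct.assoc ℂ A A A (t ⊗ₜ y)) =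
      TensorProduct.assoc ℂ A A A (t ⊗ₜ g y) := by
    intro t
    induction t with
    | zero => simp
    | add s t hs ht => simp only [map_add, TensorProduct.add_tmul, hs, ht]
    | tmul s r => simp
  simp only [frobTranspose, h', LinearMap.comp_apply, LinearEquiv.coe_coe,
    TensorProduct.lid_symm_apply, LinearMap.rTensor_tmul, LinearMap.lTensor_comp, key]
  exact hM.snake_right (g y)

end AlgData.IsDaggerFrobenius

/-! ### Transfer of the algebra axioms along a unitary family -/

section

variable {F : ι → ι → A →ₗ[ℂ] V} {M : AlgData A} {N : AlgData V}

theorem IsUnitaryFamily.isDaggerFrobenius (hF : IsUnitaryFamily F)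
    (h0 : IsEmpty ι → Subsingleton A) (hN : N.IsDaggerFrobenius)
    (hmul : ∀ i j, F i j ∘ₗ M.mul = N.mul ∘ₗ pairFamily F i j)
    (hunit : ∀ i j, F i j ∘ₗ M.unit = if i = j then N.unit else 0) : M.IsDaggerFrobenius := by
  have hmul' : ∀ i j x y, F i j (M.mul (x ⊗ₜ y)) = ∑ k, N.mul (F k j x ⊗ₜ F i k y) := by
    intro i j x y
    simpa [pairFamily] using LinearMap.congr_fun (hmul i j) (x ⊗ₜ y)
  have hunit' : ∀ i j, F i j (M.unit 1) = if i = j then N.unit 1 else 0 := by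
    intro i j
    rw [← LinearMap.comp_apply, hunit]
    split_ifs <;> rfl
  have h02 : IsEmpty ι → Subsingleton (A ⊗[ℂ] A) := fun h => by
    have := h0 h
    exact subsingleton_tensor
  have hcomul := hF.comul_comp hmul
  have hcomul' : ∀ i j x, ∑ k, TensorProduct.map (F k j) (F i k) (M.comul x) =
      N.comul (F i j x) := by
    intro i j x
    simpa [pairFamily] using (LinearMap.congr_fun (hcomul i j) x).symm
  -- Both Frobenius equations have `m† m` on the right, so it suffices to move the pair family past
  -- this composite once.
  have hcm : ∀ i j, pairFamily F i j ∘ₗ M.comul ∘ₗ M.mul =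
      (N.comul ∘ₗ N.mul) ∘ₗ pairFamily F i j := by
    intro i j
    rw [← LinearMap.comp_assoc, ← hcomul, LinearMap.comp_assoc, hmul, LinearMap.comp_assoc]
  refine ⟨?_, ?_, ?_, ?_, ?_⟩
  · refine hF.eq_of_comp_eq h0 fun i j => ?_
    refine TensorProduct.ext_threefold fun x y z => ?_
    simp only [LinearMap.comp_apply, LinearMap.rTensor_tmul, LinearMap.lTensor_tmul,
      LinearEquiv.coe_coe, TensorProduct.assoc_tmul, hmul', TensorProduct.sum_tmul,
      TensorProduct.tmul_sum, map_sum, hN.assoc_apply]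
    rw [Finset.sum_comm]
  · refine hF.eq_of_comp_eq h0 fun i j => ?_
    refine TensorProduct.ext' fun x y => ?_
    have hx : M.unit x = x • M.unit 1 := by rw [← map_smul]; simp
    simp only [LinearMap.comp_apply, LinearMap.rTensor_tmul, hx, ← TensorProduct.smul_tmul',
      map_smul, hmul', hunit', LinearEquiv.coe_coe, TensorProduct.lid_tmul]
    rw [Finset.sum_eq_single j] <;> simp +contextual [hN.one_mul_apply]
  · refine hF.eq_of_comp_eq h0 fun i j => ?_
    refine TensorProduct.ext' fun y x => ?_
    have hx : M.unit x = x • M.unit 1 := by rw [← map_smul]; simp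
    simp only [LinearMap.comp_apply, LinearMap.lTensor_tmul, hx, TensorProduct.tmul_smul,
      map_smul, hmul', hunit', LinearEquiv.coe_coe, TensorProduct.rid_tmul]
    rw [Finset.sum_eq_single i] <;> simp +contextual [hN.mul_one_apply, eq_comm]
  · refine hF.pair.eq_of_comp_eq h02 fun i j => ?_
    rw [hcm, ← hN.frobenius_left]
    refine TensorProduct.ext' fun x y => ?_
    -- A threefold crossing: the family index runs through three wires, and moving the
    -- multiplication past two of them leaves the third free to be absorbed by the comultiplication
    -- through `hcomul'`.
    have h1 : ∀ k t, TensorProduct.map (F k j) (F i k) (M.mul.rTensor A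
        ((TensorProduct.assoc ℂ A A A).symm (x ⊗ₜ t))) =
        ∑ l, N.mul.rTensor V ((TensorProduct.assoc ℂ V V V).symm
          (F l j x ⊗ₜ TensorProduct.map (F k l) (F i k) t)) := by
      intro k t
      induction t with
      | zero => simp
      | add s t hs ht =>
        simp only [map_add, TensorProduct.tmul_add, hs, ht, Finset.sum_add_distrib]
      | tmul s r => simp [hmul', TensorProduct.sum_tmul]
    simp only [pairFamily, LinearMap.comp_apply, LinearMap.sum_apply, LinearMap.lTensor_tmul,
      LinearEquiv.coe_coe, h1, map_sum, TensorProduct.map_tmul]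
    rw [Finset.sum_comm]
    simp only [← map_sum, ← TensorProduct.tmul_sum, hcomul']
  · refine hF.pair.eq_of_comp_eq h02 fun i j => ?_
    rw [hcm, ← hN.frobenius_right]
    refine TensorProduct.ext' fun x y => ?_
    have h1 : ∀ k t, TensorProduct.map (F k j) (F i k) (M.mul.lTensor A
        (TensorProduct.assoc ℂ A A A (t ⊗ₜ y))) =
        ∑ l, N.mul.lTensor V (TensorProduct.assoc ℂ V V V
          (TensorProduct.map (F k j) (F l k) t ⊗ₜ F i l y)) := by
      intro k t
      induction t with
      | zero => simp
      | add s t hs ht =>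
        simp only [map_add, TensorProduct.add_tmul, hs, ht, Finset.sum_add_distrib]
      | tmul s r => simp [hmul', TensorProduct.tmul_sum]
    simp only [pairFamily, LinearMap.comp_apply, LinearMap.sum_apply, LinearMap.rTensor_tmul,
      LinearEquiv.coe_coe, h1, map_sum, TensorProduct.map_tmul]
    rw [Finset.sum_comm]
    simp only [← map_sum, ← TensorProduct.sum_tmul, hcomul']

theorem IsUnitaryFamily.isSpecial (hF : IsUnitaryFamily F)
    (h0 : IsEmpty ι → Subsingleton A) (hN : N.IsSpecial)
    (hmul : ∀ i j, F i j ∘ₗ M.mul = N.mul ∘ₗ pairFamily F i j) : M.IsSpecial := by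
  refine hF.eq_of_comp_eq h0 fun i j => ?_
  rw [← LinearMap.comp_assoc, hmul, LinearMap.comp_assoc, ← hF.comul_comp hmul,
    ← LinearMap.comp_assoc, hN, LinearMap.id_comp, LinearMap.comp_id]

/-- Each diagonal entry `F_ii` preserves the counit, which gives one formula for the cap per index
`i`. Adding them yields a double sum in which `i` and `k` play symmetric roles. -/
theorem IsUnitaryFamily.card_smul_frobCap (hF : IsUnitaryFamily F)
    (hmul : ∀ i j, F i j ∘ₗ M.mul = N.mul ∘ₗ pairFamily F i j)
    (hunit : ∀ i j, F i j ∘ₗ M.unit = if i = j then N.unit else 0) (x y : A) :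
    (Fintype.card ι : ℂ) * M.frobCap (x ⊗ₜ y) =
      ∑ i, ∑ k, N.frobCap (F k i x ⊗ₜ F i k y) := by
  have h : ∀ i, M.frobCap (x ⊗ₜ y) = ∑ k, N.frobCap (F k i x ⊗ₜ F i k y) := by
    intro i
    have h1 := LinearMap.congr_fun (hF.counit_comp hunit i i) (M.mul (x ⊗ₜ y))
    have h2 := LinearMap.congr_fun (hmul i i) (x ⊗ₜ y)
    simp only [LinearMap.comp_apply, if_true] at h1 h2
    rw [h2] at h1
    simpa [pairFamily, AlgData.frobCap] using h1.symm
  simp [← h]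

theorem IsUnitaryFamily.frobCap_eq (hF : IsUnitaryFamily F)
    (h0 : IsEmpty ι → Subsingleton A)
    (hmul : ∀ i j, F i j ∘ₗ M.mul = N.mul ∘ₗ pairFamily F i j)
    (hunit : ∀ i j, F i j ∘ₗ M.unit = if i = j then N.unit else 0) {x y x' y' : A}
    (h : ∑ i, ∑ k, N.frobCap (F k i x ⊗ₜ F i k y) = ∑ i, ∑ k, N.frobCap (F k i x' ⊗ₜ F i k y')) :
    M.frobCap (x ⊗ₜ y) = M.frobCap (x' ⊗ₜ y') := by
  rcases isEmpty_or_nonempty ι with hι | hι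
  · have := h0 hι
    rw [Subsingleton.elim x x', Subsingleton.elim y y']
  · have hn : (Fintype.card ι : ℂ) ≠ 0 := by simp
    apply mul_left_cancel₀ hn
    rw [hF.card_smul_frobCap hmul hunit, hF.card_smul_frobCap hmul hunit, h]

end

/-- The quantum graph on `A` obtained from a quantum graph on `V` and a unitary matrix of maps
`A → V` that intertwines the structure maps. -/
def QuantumGraph.ofUnitaryFamily (Γ : QuantumGraph V) {F : ι → ι → A →ₗ[ℂ] V}
    (hF : IsUnitaryFamily F) (h0 : IsEmpty ι → Subsingleton A) (M : AlgData A) (γ : A →ₗ[ℂ] A)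
    (hmul : ∀ i j, F i j ∘ₗ M.mul = Γ.alg.mul ∘ₗ pairFamily F i j)
    (hunit : ∀ i j, F i j ∘ₗ M.unit = if i = j then Γ.alg.unit else 0)
    (hadj : ∀ i j, F i j ∘ₗ γ = Γ.adj ∘ₗ F i j) : QuantumGraph A where
  alg := M
  frobenius := hF.isDaggerFrobenius h0 Γ.frobenius hmul hunit
  special := hF.isSpecial h0 Γ.special hmul
  symmetric := TensorProduct.ext' fun x y => by
    refine hF.frobCap_eq h0 hmul hunit ?_
    -- Exchanging the two sums exchanges `F_ki` with `F_ik`, which is what the swap of the arguments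
    -- requires; the formula for a single `i` would not be invariant.
    rw [Finset.sum_comm]
    refine Finset.sum_congr rfl fun i _ => Finset.sum_congr rfl fun k _ => ?_
    simpa using LinearMap.congr_fun Γ.symmetric (F k i x ⊗ₜ F i k y)
  adj := γ
  adj_selfAdjoint := hF.eq_of_comp_eq h0 fun i j => by
    rw [hadj, hF.intertwine_adjoint hF hadj, Γ.adj_selfAdjoint]
  adj_idem := hF.eq_of_comp_eq h0 fun i j => by
    have h : pairFamily F i j ∘ₗ TensorProduct.map γ γ =
        TensorProduct.map Γ.adj Γ.adj ∘ₗ pairFamily F i j := by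
      simp only [pairFamily, sum_comp_linear, comp_sum_linear, ← TensorProduct.map_comp, hadj]
    rw [← LinearMap.comp_assoc, hmul, LinearMap.comp_assoc, ← LinearMap.comp_assoc M.comul, h,
      LinearMap.comp_assoc, ← hF.comul_comp hmul, hadj]
    conv_rhs => rw [← Γ.adj_idem]
    simp only [LinearMap.comp_assoc]
  adj_symm := by
    refine (hF.isDaggerFrobenius h0 Γ.frobenius hmul hunit).frobTranspose_eq fun x y => ?_
    refine hF.frobCap_eq h0 hmul hunit ?_
    refine Finset.sum_congr rfl fun i _ => Finset.sum_congr rfl fun k _ => ?_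
    have h := fun i j x => LinearMap.congr_fun (hadj i j) x
    simp only [LinearMap.comp_apply] at h
    rw [h, h, ← Γ.frobenius.frobCap_frobTranspose, Γ.adj_symm]
  adj_refl := hF.eq_of_comp_eq h0 fun i j => by
    have h : pairFamily F i j ∘ₗ γ.rTensor A = Γ.adj.rTensor V ∘ₗ pairFamily F i j := by
      simp only [pairFamily, sum_comp_linear, comp_sum_linear, LinearMap.rTensor,
        ← TensorProduct.map_comp, hadj, LinearMap.comp_id, LinearMap.id_comp]
    rw [← LinearMap.comp_assoc, hmul, LinearMap.comp_assoc, ← LinearMap.comp_assoc M.comul, h,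
      LinearMap.comp_assoc, ← hF.comul_comp hmul, LinearMap.comp_id]
    conv_rhs => rw [← LinearMap.id_comp (F i j), ← Γ.adj_refl]
    simp only [LinearMap.comp_assoc]

/-- Averaging the conjugates of `S` by two unitary matrices gives a map intertwined with `S`. -/
theorem IsUnitaryFamily.comp_average {F : ι → ι → A →ₗ[ℂ] V} {B : Type*} [NormedAddCommGroup B]
    [InnerProductSpace ℂ B] [FiniteDimensional ℂ B] {G : ι → ι → B →ₗ[ℂ] W}
    (hG : IsUnitaryFamily G) {S : W →ₗ[ℂ] V}
    (h : ∀ a b k j, F a b ∘ₗ LinearMap.adjoint (F k j) ∘ₗ S =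
      S ∘ₗ G a b ∘ₗ LinearMap.adjoint (G k j)) (a b : ι) :
    F a b ∘ₗ ((1 / (Fintype.card ι : ℂ)) • ∑ j, ∑ k, LinearMap.adjoint (F k j) ∘ₗ S ∘ₗ G k j) =
      S ∘ₗ G a b := by
  have : Nonempty ι := ⟨a⟩
  have hn : (Fintype.card ι : ℂ) ≠ 0 := by simp
  -- Once `F F†` has moved past `S` as `G G†`, the sum over `k` of `G_kj† G_kj` is the identity for
  -- each `j`, and the remaining sum over `j` cancels the factor `1/n`.
  have h1 : ∀ j k, F a b ∘ₗ LinearMap.adjoint (F k j) ∘ₗ S ∘ₗ G k j =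
      (S ∘ₗ G a b) ∘ₗ LinearMap.adjoint (G k j) ∘ₗ G k j := by
    intro j k
    have := congrArg (fun f => f ∘ₗ G k j) (h a b k j)
    simpa only [LinearMap.comp_assoc] using this
  simp only [LinearMap.comp_smul, comp_sum_linear, h1]
  simp only [← comp_sum_linear, hG.adjoint_comp]
  simp only [if_true, LinearMap.comp_id, Finset.sum_const, Finset.card_univ,
    LinearMap.comp_smul]
  rw [← Nat.cast_smul_eq_nsmul ℂ, smul_smul, one_div, inv_mul_cancel₀ hn, one_smul]

end Transport

/-! ### Families indexed by matrix units -/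

section MatrixUnits

variable {ι V K : Type*} [Fintype ι] [DecidableEq ι]
  [NormedAddCommGroup V] [InnerProductSpace ℂ V] [FiniteDimensional ℂ V]
  [NormedAddCommGroup K] [InnerProductSpace ℂ K] [FiniteDimensional ℂ K]

/-- The relations satisfied by the components of a quantum automorphism with respect to a basis of
matrix units if multiplication and unit of the matrix algebra are intertwiners. -/
structure IsMatrixUnitFamily (X : ι × ι → ι × ι → V →ₗ[ℂ] V) : Prop where
  mul : ∀ a b' c d c' d', ∑ b, X (a, b) (c, d) ∘ₗ X (b, b') (c', d') =
    if d = c' then X (a, b') (c, d') else 0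
  unit : ∀ a b, ∑ c, X (a, b) (c, c) = if a = b then LinearMap.id else 0

/-- This is compatibility with the counit (the trace), obtained from the unit relation by
multiplying with `X†` and using unitarity. -/
theorem IsMatrixUnitFamily.sum_diagonal {X : ι × ι → ι × ι → V →ₗ[ℂ] V}
    (hX : IsMatrixUnitFamily X) (hU : IsUnitaryFamily X) (c d : ι) :
    ∑ a, X (a, a) (c, d) = if c = d then LinearMap.id else 0 := by
  have h : ∑ a, LinearMap.adjoint (X (a, a) (c, d)) = if c = d then LinearMap.id else 0 := by
    calc ∑ a, LinearMap.adjoint (X (a, a) (c, d))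
        = ∑ p, LinearMap.adjoint (X p (c, d)) ∘ₗ ∑ e, X p (e, e) := by
          simp only [Fintype.sum_prod_type, hX.unit]
          refine Finset.sum_congr rfl fun a _ => ?_
          rw [Finset.sum_eq_single a] <;> simp +contextual [eq_comm]
      _ = ∑ e, if (c, d) = (e, e) then LinearMap.id else 0 := by
          simp only [comp_sum_linear]
          rw [Finset.sum_comm]
          simp only [hU.adjoint_comp]
      _ = _ := by
          rw [Finset.sum_eq_single c]
          · simp [eq_comm]
          · intro e _ he
            rw [if_neg fun h => he (Prod.mk.inj h).1.symm]
          · simp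
  have h2 := congrArg LinearMap.adjoint h
  rw [map_sum] at h2
  simp only [LinearMap.adjoint_adjoint] at h2
  rw [h2]
  split_ifs <;> simp

/-- The multiplication relation solved for one factor: multiply on the right by `X†` and cancel with
`X X† = 1`. -/
theorem IsMatrixUnitFamily.sum_comp_adjoint {X : ι × ι → ι × ι → V →ₗ[ℂ] V}
    (hX : IsMatrixUnitFamily X) (hU : IsUnitaryFamily X) (a b' c d p q : ι) :
    ∑ d', X (a, b') (c, d') ∘ₗ LinearMap.adjoint (X (p, q) (d, d')) =
      if b' = q then X (a, p) (c, d) else 0 := by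
  calc ∑ d', X (a, b') (c, d') ∘ₗ LinearMap.adjoint (X (p, q) (d, d'))
      = ∑ x : ι × ι, (∑ b, X (a, b) (c, d) ∘ₗ X (b, b') x) ∘ₗ
          LinearMap.adjoint (X (p, q) x) := by
        symm
        simp only [Fintype.sum_prod_type, hX.mul]
        rw [Finset.sum_eq_single d] <;> simp +contextual [eq_comm]
    _ = ∑ b, X (a, b) (c, d) ∘ₗ ∑ x, X (b, b') x ∘ₗ LinearMap.adjoint (X (p, q) x) := by
        simp only [sum_comp_linear, comp_sum_linear, LinearMap.comp_assoc]
        rw [Finset.sum_comm]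
    _ = _ := by
        simp only [hU.comp_adjoint]
        rw [Finset.sum_eq_single p]
        · by_cases h : b' = q <;> simp [h]
        · intro b _ hb
          rw [if_neg fun h => hb (Prod.mk.inj h).1, LinearMap.comp_zero]
        · simp

/-- Inserting the counit relation in front of the adjoint gives an expression that
`sum_comp_adjoint` evaluates. This is what makes the bent endomorphism self-adjoint. -/
theorem IsMatrixUnitFamily.adjoint_eq {X : ι × ι → ι × ι → V →ₗ[ℂ] V}
    (hX : IsMatrixUnitFamily X) (hU : IsUnitaryFamily X) (a b c d : ι) :
    LinearMap.adjoint (X (a, b) (c, d)) = X (b, a) (d, c) := by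
  calc LinearMap.adjoint (X (a, b) (c, d))
      = ∑ d', (∑ e, X (e, e) (d, d')) ∘ₗ LinearMap.adjoint (X (a, b) (c, d')) := by
        simp only [hX.sum_diagonal hU]
        rw [Finset.sum_eq_single d] <;> simp +contextual [eq_comm]
    _ = ∑ e, ∑ d', X (e, e) (d, d') ∘ₗ LinearMap.adjoint (X (a, b) (c, d')) := by
        simp only [sum_comp_linear]
        rw [Finset.sum_comm]
    _ = _ := by
        simp only [hX.sum_comp_adjoint hU]
        simp

/-- The normalisation `s` appears once on each side and cancels. It is required to be nonzero only
for nonempty `ι`, since the scalars of the endomorphism algebra are `0` in dimension zero. -/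
theorem isIntertwiner_mul_iff (k : OrthonormalBasis (ι × ι) ℂ K) (M : AlgData K) {s : ℂ}
    (hs : Nonempty ι → s ≠ 0)
    (hmul : ∀ a b c d, M.mul (k (a, b) ⊗ₜ k (c, d)) = if b = c then s • k (a, d) else 0)
    (X : K ⊗[ℂ] V →ₗ[ℂ] V ⊗[ℂ] K) :
    IsIntertwiner (compMap X X) X M.mul ↔
      ∀ a b' c d c' d', ∑ b, comp k X (a, b) (c, d) ∘ₗ comp k X (b, b') (c', d') =
        if d = c' then comp k X (a, b') (c, d') else 0 := by
  rw [isIntertwiner_iff (k.tensorProduct k) k]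
  have h1 : ∀ a b' c d c' d',
      ∑ x, k.repr (M.mul ((k.tensorProduct k) ((c, d), (c', d')))) x • comp k X (a, b') x =
        s • if d = c' then comp k X (a, b') (c, d') else 0 := by
    intro a b' c d c' d'
    rw [OrthonormalBasis.tensorProduct_apply, hmul]
    by_cases h : d = c'
    · rw [if_pos h, if_pos h, Finset.sum_eq_single (c, d')]
      · simp
      · intro x _ hx
        simp [hx]
      · simp
    · simp [h]
  have h2 : ∀ a b' c d c' d',
      ∑ x, k.repr (M.mul ((k.tensorProduct k) x)) (a, b') •
        comp (k.tensorProduct k) (compMap X X) x ((c, d), (c', d')) =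
        s • ∑ b, comp k X (a, b) (c, d) ∘ₗ comp k X (b, b') (c', d') := by
    intro a b' c d c' d'
    simp only [comp_compMap, Fintype.sum_prod_type, OrthonormalBasis.tensorProduct_apply, hmul]
    rw [Finset.sum_eq_single a]
    · rw [Finset.smul_sum]
      refine Finset.sum_congr rfl fun b _ => ?_
      rw [Finset.sum_eq_single b]
      · rw [Finset.sum_eq_single b']
        · simp
        · intro x _ hx
          simp [hx.symm]
        · simp
      · intro x _ hx
        simp [hx.symm]
      · simp
    · intro x _ hx
      refine Finset.sum_eq_zero fun b _ => Finset.sum_eq_zero fun c _ =>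
        Finset.sum_eq_zero fun d _ => ?_
      split_ifs <;> simp [hx.symm]
    · simp
  constructor
  · intro h a b' c d c' d'
    have := h (a, b') ((c, d), (c', d'))
    rw [h1, h2] at this
    exact (smul_right_injective _ (hs ⟨a⟩) this).symm
  · rintro h ⟨a, b'⟩ ⟨⟨c, d⟩, ⟨c', d'⟩⟩
    rw [h1, h2, h]

theorem isIntertwiner_unit_iff (k : OrthonormalBasis (ι × ι) ℂ K) (M : AlgData K) {t : ℂ}
    (ht : Nonempty ι → t ≠ 0) (hunit : M.unit 1 = t • ∑ a, k (a, a))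
    (X : K ⊗[ℂ] V →ₗ[ℂ] V ⊗[ℂ] K) :
    IsIntertwiner (idMap V) X M.unit ↔
      ∀ a b, ∑ c, comp k X (a, b) (c, c) = if a = b then LinearMap.id else 0 := by
  have h1 : ∀ a b v, coordR k V (a, b) (X (M.unit 1 ⊗ₜ v)) =
      t • (∑ c, comp k X (a, b) (c, c)) v := by
    intro a b v
    simp [hunit, TensorProduct.sum_tmul, ← TensorProduct.smul_tmul', comp]
  have h2 : ∀ a b (v : V), coordR k V (a, b) (v ⊗ₜ M.unit 1) =
      t • (if a = b then LinearMap.id else 0 : V →ₗ[ℂ] V) v := by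
    intro a b v
    simp only [hunit, TensorProduct.tmul_smul, map_smul, TensorProduct.tmul_sum, map_sum,
      coordR_basis]
    congr 1
    rw [Finset.sum_eq_single a]
    · by_cases h : a = b <;> simp [h, eq_comm]
    · intro c _ hc
      rw [if_neg fun h => hc (Prod.mk.inj h).1.symm]
    · simp
  constructor
  · intro h a b
    ext v
    have := congrArg (coordR k V (a, b)) (LinearMap.congr_fun h (1 ⊗ₜ v))
    simp only [LinearMap.comp_apply, LinearMap.rTensor_tmul, idMap, LinearEquiv.coe_coe,
      TensorProduct.comm_tmul, LinearMap.lTensor_tmul] at this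
    rw [h1, h2] at this
    exact smul_right_injective _ (ht ⟨a⟩) this
  · intro h
    refine TensorProduct.ext (LinearMap.ext_ring (LinearMap.ext fun v =>
      ext_coordR k fun ⟨a, b⟩ => ?_))
    simp [idMap, h1, h2, h]

end MatrixUnits

/-! ### Dual bases and matrix units -/

section DualBasis

variable {ι H : Type*} [Fintype ι] [DecidableEq ι]
  [NormedAddCommGroup H] [InnerProductSpace ℂ H] [FiniteDimensional ℂ H]

theorem HilbDual.inner_symm_innerSL (x y : H) :
    inner ℂ ((HilbDual.equiv H).symm (innerSL ℂ x)) ((HilbDual.equiv H).symm (innerSL ℂ y)) =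
      inner ℂ y x := by
  have : CompleteSpace H := FiniteDimensional.complete ℂ H
  change inner ℂ ((InnerProductSpace.toDual ℂ H).symm (InnerProductSpace.toDual ℂ H y))
    ((InnerProductSpace.toDual ℂ H).symm (InnerProductSpace.toDual ℂ H x)) = _
  simp

/-- The orthonormal basis of `H^*` dual to an orthonormal basis of `H`. -/
def dualBasis (b : OrthonormalBasis ι ℂ H) : OrthonormalBasis ι ℂ (HilbDual H) :=
  OrthonormalBasis.mk (v := fun i => (HilbDual.equiv H).symm (innerSL ℂ (b i)))
    (by
      rw [orthonormal_iff_ite]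
      intro i j
      rw [HilbDual.inner_symm_innerSL, b.inner_eq_ite]
      simp [eq_comm])
    (by
      intro φ _
      have h : φ = ∑ i, HilbDual.equiv H φ (b i) •
          (HilbDual.equiv H).symm (innerSL ℂ (b i)) := by
        apply (HilbDual.equiv H).injective
        rw [map_sum]
        ext x
        conv_lhs => rw [← b.sum_repr x]
        simp [b.repr_apply_apply, mul_comm]
      rw [h]
      exact Submodule.sum_mem _ fun i _ => Submodule.smul_mem _ _
        (Submodule.subset_span ⟨i, rfl⟩))

theorem dualBasis_apply (b : OrthonormalBasis ι ℂ H) (i : ι) :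
    dualBasis b i = (HilbDual.equiv H).symm (innerSL ℂ (b i)) := by
  simp [dualBasis]

theorem capDual_dualBasis_tmul (b : OrthonormalBasis ι ℂ H) (i : ι) (h : H) :
    capDual H (dualBasis b i ⊗ₜ h) = b.repr h i := by
  simp [capDual, dualBasis_apply, b.repr_apply_apply]

theorem capDual_dualBasis (b : OrthonormalBasis ι ℂ H) (i j : ι) :
    capDual H (dualBasis b i ⊗ₜ b j) = if i = j then 1 else 0 := by
  simp [capDual_dualBasis_tmul]

variable (H) in
theorem cup_one : cup H 1 = ∑ i, stdOrthonormalBasis ℂ H i ⊗ₜ[ℂ]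
    dualBasis (stdOrthonormalBasis ℂ H) i := by
  simp [cup, dualBasis_apply]

variable (H) in
theorem cupDual_one : cupDual H 1 = ∑ i, dualBasis (stdOrthonormalBasis ℂ H) i ⊗ₜ[ℂ]
    stdOrthonormalBasis ℂ H i := by
  simp [cupDual, cup_one]

variable (H) in
/-- The orthonormal basis of matrix units of `H ⊗ H^*`. -/
def endBasis : OrthonormalBasis (Fin (Module.finrank ℂ H) × Fin (Module.finrank ℂ H)) ℂ
    (H ⊗[ℂ] HilbDual H) :=
  (stdOrthonormalBasis ℂ H).tensorProduct (dualBasis (stdOrthonormalBasis ℂ H))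

theorem endBasis_apply (i j : Fin (Module.finrank ℂ H)) :
    endBasis H (i, j) = stdOrthonormalBasis ℂ H i ⊗ₜ dualBasis (stdOrthonormalBasis ℂ H) j := by
  simp [endBasis, OrthonormalBasis.tensorProduct_apply]

variable (H) in
/-- The normalisation `1 / √n` of the multiplication of the endomorphism algebra. -/
def endScalar : ℂ := ((1 / Real.sqrt (Module.finrank ℂ H) : ℝ) : ℂ)

variable (H) in
/-- The square root of the dimension of `H` as a complex number. -/
def sqrtDim : ℂ := ((Real.sqrt (Module.finrank ℂ H) : ℝ) : ℂ)

theorem endAlg_mul_basis (a b c d : Fin (Module.finrank ℂ H)) :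
    (endAlg H).mul (endBasis H (a, b) ⊗ₜ endBasis H (c, d)) =
      if b = c then endScalar H • endBasis H (a, d) else 0 := by
  simp only [endBasis_apply, endAlg, endScalar]
  split_ifs with h <;> simp [capDual_dualBasis, h]

theorem endAlg_unit_one :
    (endAlg H).unit 1 = sqrtDim H •
      ∑ a, endBasis H (a, a) := by
  change (sqrtDim H • cup H) 1 = _
  simp [endBasis_apply, cup_one]

theorem endScalar_mul_sqrt (h : Nonempty (Fin (Module.finrank ℂ H))) :
    endScalar H * sqrtDim H = 1 := by
  have h1 : (0 : ℝ) < Module.finrank ℂ H := by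
    exact_mod_cast Fin.pos_iff_nonempty.2 h
  rw [endScalar, sqrtDim, ← Complex.ofReal_mul, one_div, inv_mul_cancel₀ (Real.sqrt_pos.2 h1).ne',
    Complex.ofReal_one]

theorem sqrtDim_mul_self :
    sqrtDim H * sqrtDim H =
      (Module.finrank ℂ H : ℂ) := by
  rw [sqrtDim, ← Complex.ofReal_mul, Real.mul_self_sqrt (Nat.cast_nonneg _), Complex.ofReal_natCast]

theorem endAlg_comul_basis (a d : Fin (Module.finrank ℂ H)) :
    (endAlg H).comul (endBasis H (a, d)) =
      endScalar H • ∑ j, endBasis H (a, j) ⊗ₜ[ℂ] endBasis H (j, d) := by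
  apply ((endBasis H).tensorProduct (endBasis H)).repr.injective
  ext ⟨⟨x, y⟩, ⟨z, w⟩⟩
  rw [OrthonormalBasis.repr_apply_apply, OrthonormalBasis.repr_apply_apply, AlgData.comul,
    LinearMap.adjoint_inner_right, OrthonormalBasis.tensorProduct_apply, endAlg_mul_basis]
  have hs : starRingEnd ℂ (endScalar H) = endScalar H := Complex.conj_ofReal _
  simp only [inner_smul_right, inner_sum, TensorProduct.inner_tmul,
    OrthonormalBasis.inner_eq_ite, Prod.mk.injEq]
  by_cases hyz : y = z
  · subst hyz
    rw [if_pos rfl, inner_smul_left, hs, OrthonormalBasis.inner_eq_ite,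
      Finset.sum_eq_single y]
    · by_cases hx : x = a <;> by_cases hw : w = d <;> simp [hx, hw]
    · intro j _ hj
      simp [hj.symm]
    · simp
  · rw [if_neg hyz, inner_zero_left, Finset.sum_eq_zero, mul_zero]
    intro j _
    by_cases h1 : y = j
    · have : z ≠ j := fun h => hyz (h1.trans h.symm)
      simp [this]
    · simp [h1]

theorem endBasis_ext {M : Type*} [AddCommMonoid M] [Module ℂ M]
    {S T : H ⊗[ℂ] HilbDual H →ₗ[ℂ] M}
    (h : ∀ a b, S (endBasis H (a, b)) = T (endBasis H (a, b))) : S = T :=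
  (endBasis H).toBasis.ext fun ⟨a, b⟩ => by simpa using h a b

theorem endBasis_ext₂ {M : Type*} [AddCommMonoid M] [Module ℂ M]
    {S T : (H ⊗[ℂ] HilbDual H) ⊗[ℂ] (H ⊗[ℂ] HilbDual H) →ₗ[ℂ] M}
    (h : ∀ a b c d, S (endBasis H (a, b) ⊗ₜ endBasis H (c, d)) =
      T (endBasis H (a, b) ⊗ₜ endBasis H (c, d))) : S = T :=
  TensorProduct.ext (endBasis_ext fun a b => endBasis_ext fun c d => h a b c d)

variable (H) in
theorem endAlg_isDaggerFrobenius : (endAlg H).IsDaggerFrobenius where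
  mul_assoc := by
    refine TensorProduct.ext (endBasis_ext₂ fun a b c d => endBasis_ext fun e f => ?_)
    by_cases h1 : b = c <;> by_cases h2 : d = e <;>
    simp [endAlg_mul_basis, h1, h2, ← TensorProduct.smul_tmul']
  unit_mul := by
    refine TensorProduct.ext (LinearMap.ext_ring (endBasis_ext fun a b => ?_))
    have h := endScalar_mul_sqrt (H := H) ⟨a⟩
    simp [endAlg_unit_one, TensorProduct.sum_tmul, ← TensorProduct.smul_tmul', endAlg_mul_basis,
      smul_smul, mul_comm (sqrtDim H), h]
  mul_unit := by
    refine TensorProduct.ext (endBasis_ext fun a b => LinearMap.ext_ring ?_)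
    have h := endScalar_mul_sqrt (H := H) ⟨a⟩
    simp [endAlg_unit_one, TensorProduct.tmul_sum, endAlg_mul_basis,
      smul_smul, mul_comm (sqrtDim H), h]
  frobenius_left := by
    refine endBasis_ext₂ fun a b c d => ?_
    by_cases h : b = c <;>
    simp [endAlg_mul_basis, endAlg_comul_basis, TensorProduct.tmul_sum, h,
      ← TensorProduct.smul_tmul', Finset.smul_sum]
  frobenius_right := by
    refine endBasis_ext₂ fun a b c d => ?_
    by_cases h : b = c <;>
    simp [endAlg_mul_basis, endAlg_comul_basis, TensorProduct.sum_tmul, h,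
      ← TensorProduct.smul_tmul', Finset.smul_sum]

end DualBasis

/-! ### `*`-isomorphisms are unitary -/

section StarIso

variable {A B : Type*}
  [NormedAddCommGroup A] [InnerProductSpace ℂ A] [FiniteDimensional ℂ A]
  [NormedAddCommGroup B] [InnerProductSpace ℂ B] [FiniteDimensional ℂ B]
  {M : AlgData A} {N : AlgData B} {f : A →ₗ[ℂ] B}

/-- Preserving multiplication and counit, `f` preserves caps, so its Frobenius transpose is a left
inverse by the snake equation. Preservation of cups gives the right inverse in
`IsStarIso.comp_adjoint`. -/
theorem IsStarIso.adjoint_comp (hf : IsStarIso M N f) (hM : M.IsDaggerFrobenius) :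
    LinearMap.adjoint f ∘ₗ f = LinearMap.id := by
  rw [hf.starHom.adjoint_eq]
  have h : (N.frobCap ∘ₗ f.rTensor B) ∘ₗ f.lTensor A = M.frobCap := by
    refine TensorProduct.ext' fun x y => ?_
    have h1 := LinearMap.congr_fun hf.starHom.map_mul (x ⊗ₜ y)
    have h2 := LinearMap.congr_fun hf.starCohom.map_counit (M.mul (x ⊗ₜ y))
    simp only [LinearMap.comp_apply, TensorProduct.map_tmul] at h1 h2
    rw [h1] at h2
    simpa [AlgData.frobCap] using h2
  ext x
  have key : ∀ t : A ⊗[ℂ] A, TensorProduct.assoc ℂ A A B (t ⊗ₜ f x) =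
      (f.lTensor A).lTensor A (TensorProduct.assoc ℂ A A A (t ⊗ₜ x)) := by
    intro t
    induction t with
    | zero => simp
    | add s t hs ht => simp only [map_add, TensorProduct.add_tmul, hs, ht]
    | tmul s r => simp
  simp only [frobTranspose, LinearMap.comp_apply, LinearEquiv.coe_coe,
    TensorProduct.lid_symm_apply, LinearMap.rTensor_tmul, key]
  rw [← LinearMap.comp_apply, ← LinearMap.lTensor_comp, h]
  exact hM.snake_right x

theorem IsStarIso.comp_adjoint (hf : IsStarIso M N f) (hN : N.IsDaggerFrobenius) :
    f ∘ₗ LinearMap.adjoint f = LinearMap.id := by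
  rw [hf.starHom.adjoint_eq]
  have h : N.frobCup 1 = TensorProduct.map f f (M.frobCup 1) := by
    rw [AlgData.frobCup, LinearMap.comp_apply, ← hf.starHom.map_unit]
    exact LinearMap.congr_fun hf.starCohom.map_comul _
  ext x
  have key : ∀ t : A ⊗[ℂ] A, f (TensorProduct.rid ℂ A ((N.frobCap ∘ₗ f.rTensor B).lTensor A
      (TensorProduct.assoc ℂ A A B (t ⊗ₜ x)))) =
      TensorProduct.rid ℂ B (N.frobCap.lTensor B
        (TensorProduct.assoc ℂ B B B (TensorProduct.map f f t ⊗ₜ x))) := by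
    intro t
    induction t with
    | zero => simp
    | add s t hs ht => simp only [map_add, TensorProduct.add_tmul, hs, ht]
    | tmul s r => simp
  simp only [frobTranspose, LinearMap.comp_apply, LinearEquiv.coe_coe,
    TensorProduct.lid_symm_apply, LinearMap.rTensor_tmul]
  exact (key _).trans (by rw [← h]; exact hN.snake_right x)

/-- A `*`-isomorphism of dagger Frobenius algebras as a unitary map. -/
def IsStarIso.toIsometryEquiv (hf : IsStarIso M N f) (hM : M.IsDaggerFrobenius)
    (hN : N.IsDaggerFrobenius) : A ≃ₗᵢ[ℂ] B :=
  (LinearEquiv.ofLinearMap f (LinearMap.adjoint f) (hf.comp_adjoint hN)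
    (hf.adjoint_comp hM)).isometryOfInner fun x y => by
      change inner ℂ (f x) (f y) = _
      rw [← LinearMap.adjoint_inner_right, ← LinearMap.comp_apply, hf.adjoint_comp hM]
      rfl

end StarIso

/-! ### Bending wires in components -/

section Bending

variable {ι V W A B H : Type*} [Fintype ι] [DecidableEq ι]
  [NormedAddCommGroup V] [InnerProductSpace ℂ V] [FiniteDimensional ℂ V]
  [NormedAddCommGroup W] [InnerProductSpace ℂ W] [FiniteDimensional ℂ W]
  [NormedAddCommGroup A] [InnerProductSpace ℂ A] [FiniteDimensional ℂ A]
  [NormedAddCommGroup B] [InnerProductSpace ℂ B] [FiniteDimensional ℂ B]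
  [NormedAddCommGroup H] [InnerProductSpace ℂ H] [FiniteDimensional ℂ H]

/-- The adjoint transposes the `H`-indices and bending the `H`-wires transposes them back, so only
the entries are replaced by their adjoints. -/
theorem comp_dualMap (P : H ⊗[ℂ] V →ₗ[ℂ] W ⊗[ℂ] H) (i j : Fin (Module.finrank ℂ H)) :
    comp (dualBasis (stdOrthonormalBasis ℂ H)) (dualMap P) i j =
      LinearMap.adjoint (comp (stdOrthonormalBasis ℂ H) P i j) := by
  refine comp_eq_of_apply _ (F := fun i j =>
    LinearMap.adjoint (comp (stdOrthonormalBasis ℂ H) P i j)) (fun j w => ?_) i j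
  simp only [dualMap, LinearMap.comp_apply, LinearMap.lTensor_tmul, LinearEquiv.coe_coe,
    TensorProduct.rid_symm_apply, cup_one, TensorProduct.tmul_sum, map_sum,
    TensorProduct.assoc_symm_tmul, LinearMap.rTensor_tmul, TensorProduct.sum_tmul,
    apply_tmul_basis (stdOrthonormalBasis ℂ H) (LinearMap.adjoint P), TensorProduct.assoc_tmul,
    capDual_dualBasis, TensorProduct.lid_tmul, compOp_adjoint]
  simp

theorem loop_eq (T : H ⊗[ℂ] A →ₗ[ℂ] H ⊗[ℂ] B) :
    loop T = (1 / (Fintype.card (Fin (Module.finrank ℂ H)) : ℂ)) •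
      ∑ j, compL (stdOrthonormalBasis ℂ H) T j j := by
  have h : ∀ (i : Fin (Module.finrank ℂ H)) (t : H ⊗[ℂ] B),
      TensorProduct.lid ℂ B ((capDual H).rTensor B ((TensorProduct.assoc ℂ (HilbDual H) H B).symm
        (dualBasis (stdOrthonormalBasis ℂ H) i ⊗ₜ t))) =
      coordL (stdOrthonormalBasis ℂ H) B i t := by
    intro i t
    induction t with
    | zero => simp
    | add s t hs ht => simp only [map_add, TensorProduct.tmul_add, hs, ht]
    | tmul h v => simp [capDual_dualBasis_tmul, coordL_tmul]
  ext x
  simp [loop, cupDual_one, TensorProduct.sum_tmul, h, compL]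

theorem loop_adjoint_comp (P : H ⊗[ℂ] B →ₗ[ℂ] V ⊗[ℂ] H) (S : W →ₗ[ℂ] V)
    (T : H ⊗[ℂ] A →ₗ[ℂ] W ⊗[ℂ] H) :
    loop (LinearMap.adjoint P ∘ₗ S.rTensor H ∘ₗ T) =
      (1 / (Fintype.card (Fin (Module.finrank ℂ H)) : ℂ)) • ∑ j, ∑ k,
        LinearMap.adjoint (comp (stdOrthonormalBasis ℂ H) P k j) ∘ₗ S ∘ₗ
          comp (stdOrthonormalBasis ℂ H) T k j := by
  simp only [loop_eq, compL_adjoint_comp, comp_rTensor_comp]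

/-- The inclusion `v ↦ ⟪b c, -⟫ ⊗ v ⊗ b a` of `V` into `H^* ⊗ V ⊗ H`. -/
def tripleIncl (b : OrthonormalBasis ι ℂ H) (V : Type*) [NormedAddCommGroup V]
    [InnerProductSpace ℂ V] (p : ι × ι) : V →ₗ[ℂ] HilbDual H ⊗[ℂ] (V ⊗[ℂ] H) :=
  mk ℂ (HilbDual H) (V ⊗[ℂ] H) (dualBasis b p.1) ∘ₗ (mk ℂ V H).flip (b p.2)

/-- The coordinates of an element of `H^* ⊗ V ⊗ H`. -/
def tripleCoord (b : OrthonormalBasis ι ℂ H) (V : Type*) [NormedAddCommGroup V]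
    [InnerProductSpace ℂ V] (p : ι × ι) : HilbDual H ⊗[ℂ] (V ⊗[ℂ] H) →ₗ[ℂ] V :=
  coordR b V p.2 ∘ₗ coordL (dualBasis b) (V ⊗[ℂ] H) p.1

theorem tripleCoord_tmul_basis (b : OrthonormalBasis ι ℂ H) (p : ι × ι) (c a : ι) (v : V) :
    tripleCoord b V p (dualBasis b c ⊗ₜ (v ⊗ₜ b a)) = if p = (c, a) then v else 0 := by
  obtain ⟨c', a'⟩ := p
  simp only [tripleCoord, LinearMap.comp_apply, coordL_basis]
  by_cases h1 : c' = c <;> by_cases h2 : a' = a <;> simp [h1, h2, coordR_basis]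

theorem tripleCoord_comp_tripleIncl (b : OrthonormalBasis ι ℂ H) (p q : ι × ι) :
    tripleCoord b V p ∘ₗ tripleIncl b V q = if p = q then LinearMap.id else 0 := by
  ext v
  refine (tripleCoord_tmul_basis b p q.1 q.2 v).trans ?_
  split_ifs <;> rfl

theorem triple_ext {M : Type*} [AddCommMonoid M] [Module ℂ M] (b : OrthonormalBasis ι ℂ H)
    {S T : HilbDual H ⊗[ℂ] (V ⊗[ℂ] H) →ₗ[ℂ] M}
    (h : ∀ c a v, S (dualBasis b c ⊗ₜ (v ⊗ₜ b a)) = T (dualBasis b c ⊗ₜ (v ⊗ₜ b a))) : S = T := by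
  refine linearMap_ext_basis_left (dualBasis b) fun c z => ?_
  exact LinearMap.congr_fun (linearMap_ext_basis_right b
    (S := S ∘ₗ mk ℂ _ _ (dualBasis b c)) (T := T ∘ₗ mk ℂ _ _ (dualBasis b c))
    fun a v => h c a v) z

variable (V) in
theorem sum_tripleIncl_comp_tripleCoord (b : OrthonormalBasis ι ℂ H) :
    ∑ p, tripleIncl b V p ∘ₗ tripleCoord b V p = LinearMap.id := by
  refine triple_ext b fun c a v => ?_
  simp only [LinearMap.sum_apply, LinearMap.comp_apply, tripleCoord_tmul_basis]
  rw [Finset.sum_eq_single (c, a)]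
  · simp [tripleIncl]
  · intro p _ hp
    simp [hp]
  · simp

theorem adjoint_tripleIncl (b : OrthonormalBasis ι ℂ H) (p : ι × ι) :
    LinearMap.adjoint (tripleIncl b V p) = tripleCoord b V p := by
  symm
  rw [LinearMap.eq_adjoint_iff]
  intro t v
  rw [← inner_conj_symm, ← inner_conj_symm t]
  congr 1
  refine (inner_tmul_basis b v p.2 _).symm.trans ?_
  exact (inner_basis_tmul (dualBasis b) (v ⊗ₜ b p.2) p.1 t).symm

theorem adjoint_tripleCoord (b : OrthonormalBasis ι ℂ H) (p : ι × ι) :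
    LinearMap.adjoint (tripleCoord b V p) = tripleIncl b V p := by
  rw [← adjoint_tripleIncl, LinearMap.adjoint_adjoint]

/-- With `p = (c,a)` and `q = (d,k)`, the input index `c` of `X` becomes an output index and the
output index `k` an input index, while `a` and `d` keep their roles. -/
theorem bendEndo_eq (X : (H ⊗[ℂ] HilbDual H) ⊗[ℂ] V →ₗ[ℂ] V ⊗[ℂ] (H ⊗[ℂ] HilbDual H)) :
    bendEndo X = (1 / (Module.finrank ℂ H : ℂ)) • ∑ p, ∑ q,
      tripleIncl (stdOrthonormalBasis ℂ H) V p ∘ₗ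
        comp (endBasis H) X (p.2, q.2) (p.1, q.1) ∘ₗ
        tripleCoord (stdOrthonormalBasis ℂ H) V q := by
  refine triple_ext (stdOrthonormalBasis ℂ H) fun d k v => ?_
  have h : ∀ (c : Fin (Module.finrank ℂ H)),
      (stdOrthonormalBasis ℂ H c ⊗ₜ[ℂ] dualBasis (stdOrthonormalBasis ℂ H) d) ⊗ₜ[ℂ] v =
        endBasis H (c, d) ⊗ₜ v := fun c => by rw [endBasis_apply]
  have h2 : ∀ x a b, TensorProduct.rid ℂ H ((capDual H).lTensor H
      (TensorProduct.assoc ℂ H (HilbDual H) H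
        (endBasis H (a, b) ⊗ₜ stdOrthonormalBasis ℂ H x))) =
      if b = x then stdOrthonormalBasis ℂ H a else 0 := by
    intro x a b
    rw [endBasis_apply]
    simp only [TensorProduct.assoc_tmul, LinearMap.lTensor_tmul, capDual_dualBasis,
      TensorProduct.rid_tmul]
    split_ifs <;> simp
  simp only [bendEndo, LinearMap.smul_apply, LinearMap.comp_apply, LinearMap.sum_apply,
    tripleCoord_tmul_basis, LinearEquiv.coe_coe, TensorProduct.lid_symm_apply,
    LinearMap.rTensor_tmul, cupDual_one, TensorProduct.sum_tmul, map_sum,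
    TensorProduct.assoc_tmul, LinearMap.lTensor_tmul, TensorProduct.assoc_symm_tmul, h,
    apply_basis_tmul (endBasis H) X, h2]
  congr 1
  have h3 : ∀ p : Fin (Module.finrank ℂ H) × Fin (Module.finrank ℂ H),
      ∑ q, tripleIncl (stdOrthonormalBasis ℂ H) V p
        (comp (endBasis H) X (p.2, q.2) (p.1, q.1) (if q = (d, k) then v else 0)) =
      tripleIncl (stdOrthonormalBasis ℂ H) V p
        (comp (endBasis H) X (p.2, k) (p.1, d) v) := by
    intro p
    rw [Finset.sum_eq_single (d, k)]
    · simp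
    · intro q _ hq
      simp [hq]
    · simp
  simp only [h3, Fintype.sum_prod_type, TensorProduct.tmul_sum]
  refine Finset.sum_congr rfl fun c _ => Finset.sum_congr rfl fun a _ => ?_
  rw [Finset.sum_eq_single k]
  · simp [tripleIncl]
  · intro q _ hq
    simp [hq]
  · simp

theorem comp_unbend (i : A →ₗ[ℂ] HilbDual H ⊗[ℂ] (V ⊗[ℂ] H)) (a c : Fin (Module.finrank ℂ H)) :
    comp (stdOrthonormalBasis ℂ H) (unbend i) a c =
      sqrtDim H • (tripleCoord (stdOrthonormalBasis ℂ H) V (c, a) ∘ₗ i) := by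
  have h : ∀ t : HilbDual H ⊗[ℂ] (V ⊗[ℂ] H),
      TensorProduct.lid ℂ (V ⊗[ℂ] H) ((cap H).rTensor (V ⊗[ℂ] H)
        ((TensorProduct.assoc ℂ H (HilbDual H) (V ⊗[ℂ] H)).symm
          (stdOrthonormalBasis ℂ H c ⊗ₜ t))) =
      coordL (dualBasis (stdOrthonormalBasis ℂ H)) (V ⊗[ℂ] H) c t := by
    intro t
    rw [← sum_coordL (dualBasis (stdOrthonormalBasis ℂ H)) t]
    simp only [TensorProduct.tmul_sum, map_sum, TensorProduct.assoc_symm_tmul,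
      LinearMap.rTensor_tmul, TensorProduct.lid_tmul, cap, LinearMap.comp_apply,
      LinearEquiv.coe_coe, TensorProduct.comm_tmul, capDual_dualBasis, coordL_basis]
    refine Finset.sum_congr rfl fun d _ => ?_
    by_cases hd : d = c
    · simp [hd]
    · simp [hd, Ne.symm hd]
  ext x
  change coordR (stdOrthonormalBasis ℂ H) V a (sqrtDim H • _) = _
  rw [map_smul]
  refine congrArg (sqrtDim H • ·) (congrArg _ (h (i x)))

end Bending

/-! ### Splitting the bent idempotent -/

section SplittingIdempotent

variable {V A H : Type*}
  [NormedAddCommGroup V] [InnerProductSpace ℂ V] [FiniteDimensional ℂ V]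
  [NormedAddCommGroup A] [InnerProductSpace ℂ A] [FiniteDimensional ℂ A]
  [NormedAddCommGroup H] [InnerProductSpace ℂ H] [FiniteDimensional ℂ H]

/-- A dagger idempotent on a finite-dimensional Hilbert space splits through an isometry. -/
theorem exists_isometry_of_idempotent {E : Type u} [NormedAddCommGroup E] [InnerProductSpace ℂ E]
    [FiniteDimensional ℂ E] {y : E →ₗ[ℂ] E} (hy : LinearMap.adjoint y = y) (hyy : y ∘ₗ y = y) :
    ∃ (A : Type u) (_ : NormedAddCommGroup A) (_ : InnerProductSpace ℂ A)
      (_ : FiniteDimensional ℂ A) (i : A →ₗ[ℂ] E),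
      LinearMap.adjoint i ∘ₗ i = LinearMap.id ∧ i ∘ₗ LinearMap.adjoint i = y := by
  have hfix : ∀ a : LinearMap.range y, y a = a := by
    rintro ⟨_, ⟨x, rfl⟩⟩
    exact LinearMap.congr_fun hyy x
  -- A self-adjoint idempotent is the orthogonal projection onto its range, so its corestriction is
  -- adjoint to the inclusion.
  have hadj : y.rangeRestrict = LinearMap.adjoint (LinearMap.range y).subtype := by
    rw [LinearMap.eq_adjoint_iff]
    intro x a
    change inner ℂ (y x) (a : E) = inner ℂ x (a : E)
    have h := LinearMap.adjoint_inner_left y (a : E) x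
    rwa [hy, hfix] at h
  refine ⟨LinearMap.range y, inferInstance, inferInstance, inferInstance,
    (LinearMap.range y).subtype, ?_, ?_⟩
  · rw [← hadj]
    ext a
    exact hfix a
  · rw [← hadj]
    rfl

/-- The endomorphism of `H^* ⊗ V ⊗ H` obtained by bending a matrix of maps `V → V` indexed by
matrix units. -/
def bentFamily (H : Type*) [NormedAddCommGroup H] [InnerProductSpace ℂ H] [FiniteDimensional ℂ H]
    (X : Fin (Module.finrank ℂ H) × Fin (Module.finrank ℂ H) →
      Fin (Module.finrank ℂ H) × Fin (Module.finrank ℂ H) → V →ₗ[ℂ] V) :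
    HilbDual H ⊗[ℂ] (V ⊗[ℂ] H) →ₗ[ℂ] HilbDual H ⊗[ℂ] (V ⊗[ℂ] H) :=
  (1 / (Module.finrank ℂ H : ℂ)) • ∑ p, ∑ q,
    tripleIncl (stdOrthonormalBasis ℂ H) V p ∘ₗ X (p.2, q.2) (p.1, q.1) ∘ₗ
      tripleCoord (stdOrthonormalBasis ℂ H) V q

variable {X : Fin (Module.finrank ℂ H) × Fin (Module.finrank ℂ H) →
  Fin (Module.finrank ℂ H) × Fin (Module.finrank ℂ H) → V →ₗ[ℂ] V}

theorem tripleCoord_bentFamily_tripleIncl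
    (p q : Fin (Module.finrank ℂ H) × Fin (Module.finrank ℂ H)) :
    tripleCoord (stdOrthonormalBasis ℂ H) V p ∘ₗ bentFamily H X ∘ₗ
      tripleIncl (stdOrthonormalBasis ℂ H) V q =
    (1 / (Module.finrank ℂ H : ℂ)) • X (p.2, q.2) (p.1, q.1) := by
  simp only [bentFamily, LinearMap.smul_comp, LinearMap.comp_smul, sum_comp_linear,
    comp_sum_linear, LinearMap.comp_assoc, tripleCoord_comp_tripleIncl]
  congr 1
  rw [Finset.sum_eq_single p]
  · rw [Finset.sum_eq_single q]
    · rw [← LinearMap.comp_assoc, tripleCoord_comp_tripleIncl]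
      simp
    · intro r _ hr
      simp [hr]
    · simp
  · intro r _ hr
    refine Finset.sum_eq_zero fun s _ => ?_
    rw [← LinearMap.comp_assoc, tripleCoord_comp_tripleIncl, if_neg hr.symm, LinearMap.zero_comp]
  · simp

theorem adjoint_bentFamily (hX : IsMatrixUnitFamily X) (hU : IsUnitaryFamily X) :
    LinearMap.adjoint (bentFamily H X) = bentFamily H X := by
  simp only [bentFamily, map_smulₛₗ, map_sum, LinearMap.adjoint_comp, adjoint_tripleIncl,
    adjoint_tripleCoord, hX.adjoint_eq hU, LinearMap.comp_assoc]
  rw [Finset.sum_comm]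
  simp

/-- In the block product, the sum over the second component of the middle index is the
multiplication relation. The first component is then free, and its `n` values reduce `1/n²` to
`1/n`. -/
theorem bentFamily_comp_self (hX : IsMatrixUnitFamily X) :
    bentFamily H X ∘ₗ bentFamily H X = bentFamily H X := by
  let b := stdOrthonormalBasis ℂ H
  have h : ∀ p q, tripleCoord b V p ∘ₗ (bentFamily H X ∘ₗ bentFamily H X) ∘ₗ tripleIncl b V q =
      tripleCoord b V p ∘ₗ bentFamily H X ∘ₗ tripleIncl b V q := by
    rintro ⟨c, a⟩ ⟨d, k⟩
    have hn : (Module.finrank ℂ H : ℂ) ≠ 0 := by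
      have : 0 < Module.finrank ℂ H := Fin.pos_iff_nonempty.2 ⟨a⟩
      exact_mod_cast this.ne'
    calc tripleCoord b V (c, a) ∘ₗ (bentFamily H X ∘ₗ bentFamily H X) ∘ₗ tripleIncl b V (d, k)
        = tripleCoord b V (c, a) ∘ₗ bentFamily H X ∘ₗ
            (∑ r, tripleIncl b V r ∘ₗ tripleCoord b V r) ∘ₗ bentFamily H X ∘ₗ
            tripleIncl b V (d, k) := by
          rw [sum_tripleIncl_comp_tripleCoord]; rfl
      _ = ∑ r, (tripleCoord b V (c, a) ∘ₗ bentFamily H X ∘ₗ tripleIncl b V r) ∘ₗ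
            (tripleCoord b V r ∘ₗ bentFamily H X ∘ₗ tripleIncl b V (d, k)) := by
          simp only [sum_comp_linear, comp_sum_linear]
          rfl
      _ = tripleCoord b V (c, a) ∘ₗ bentFamily H X ∘ₗ tripleIncl b V (d, k) := by
          simp only [b, tripleCoord_bentFamily_tripleIncl, LinearMap.smul_comp,
            LinearMap.comp_smul, ← Finset.smul_sum, Fintype.sum_prod_type, hX.mul]
          simp only [if_true, Finset.sum_const, Finset.card_univ, Fintype.card_fin]
          rw [← Nat.cast_smul_eq_nsmul ℂ, smul_smul, smul_smul]
          congr 1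
          field_simp
  have hsum := sum_tripleIncl_comp_tripleCoord V b
  have expand : ∀ y : HilbDual H ⊗[ℂ] (V ⊗[ℂ] H) →ₗ[ℂ] HilbDual H ⊗[ℂ] (V ⊗[ℂ] H),
      y = ∑ p, ∑ q, tripleIncl b V p ∘ₗ (tripleCoord b V p ∘ₗ y ∘ₗ tripleIncl b V q) ∘ₗ
        tripleCoord b V q := by
    intro y
    calc y = (∑ p, tripleIncl b V p ∘ₗ tripleCoord b V p) ∘ₗ y ∘ₗ
          ∑ q, tripleIncl b V q ∘ₗ tripleCoord b V q := by rw [hsum]; rfl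
      _ = _ := by
        simp only [sum_comp_linear, comp_sum_linear]
        rw [Finset.sum_comm]
        rfl
  rw [expand (bentFamily H X ∘ₗ bentFamily H X)]
  simp only [h]
  rw [← expand]

/-! ### The unitary family of the bent isometry -/

section

variable {i : A →ₗ[ℂ] HilbDual H ⊗[ℂ] (V ⊗[ℂ] H)}

/-- The two factors `√n` cancel the `1/n` in the blocks of `i i†`. This factorisation of `X` drives
the rest of the proof. -/
theorem comp_unbend_comp_adjoint (hi : i ∘ₗ LinearMap.adjoint i = bentFamily H X)
    (a c k d : Fin (Module.finrank ℂ H)) :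
    comp (stdOrthonormalBasis ℂ H) (unbend i) a c ∘ₗ
      LinearMap.adjoint (comp (stdOrthonormalBasis ℂ H) (unbend i) k d) = X (a, k) (c, d) := by
  have hn : (Module.finrank ℂ H : ℂ) ≠ 0 := by
    have : 0 < Module.finrank ℂ H := Fin.pos_iff_nonempty.2 ⟨a⟩
    exact_mod_cast this.ne'
  have hc : starRingEnd ℂ (sqrtDim H) = sqrtDim H := Complex.conj_ofReal _
  have h : tripleCoord (stdOrthonormalBasis ℂ H) V (c, a) ∘ₗ i ∘ₗ LinearMap.adjoint i ∘ₗ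
      tripleIncl (stdOrthonormalBasis ℂ H) V (d, k) =
      (1 / (Module.finrank ℂ H : ℂ)) • X (a, k) (c, d) := by
    rw [← tripleCoord_bentFamily_tripleIncl (X := X) (c, a) (d, k), ← hi]
    rfl
  simp only [comp_unbend, map_smulₛₗ, LinearMap.adjoint_comp, adjoint_tripleCoord, hc,
    LinearMap.smul_comp, LinearMap.comp_smul, LinearMap.comp_assoc, h, smul_smul]
  rw [← mul_assoc, sqrtDim_mul_self]
  simp [hn]

theorem eq_of_comp_unbend_comp_eq (hi : LinearMap.adjoint i ∘ₗ i = LinearMap.id)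
    {M : Type*} [AddCommMonoid M] [Module ℂ M] {S T : M →ₗ[ℂ] A}
    (h : ∀ a c, comp (stdOrthonormalBasis ℂ H) (unbend i) a c ∘ₗ S =
      comp (stdOrthonormalBasis ℂ H) (unbend i) a c ∘ₗ T) : S = T := by
  have h1 : ∀ p, tripleCoord (stdOrthonormalBasis ℂ H) V p ∘ₗ i ∘ₗ S =
      tripleCoord (stdOrthonormalBasis ℂ H) V p ∘ₗ i ∘ₗ T := by
    rintro ⟨c, a⟩
    have hs : sqrtDim H ≠ 0 := right_ne_zero_of_mul (a := endScalar H) (by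
      rw [endScalar_mul_sqrt ⟨a⟩]; exact one_ne_zero)
    have := h a c
    rw [comp_unbend, LinearMap.smul_comp, LinearMap.smul_comp] at this
    exact smul_right_injective _ hs this
  have h2 : i ∘ₗ S = i ∘ₗ T := by
    rw [← LinearMap.id_comp (i ∘ₗ S), ← LinearMap.id_comp (i ∘ₗ T),
      ← sum_tripleIncl_comp_tripleCoord V (stdOrthonormalBasis ℂ H)]
    ext x
    simp only [LinearMap.comp_apply, LinearMap.sum_apply]
    exact Finset.sum_congr rfl fun p _ => congrArg _ (LinearMap.congr_fun (h1 p) x)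
  rw [← LinearMap.id_comp S, ← LinearMap.id_comp T, ← hi, LinearMap.comp_assoc, h2]
  rfl

theorem subsingleton_of_isEmpty (hi : LinearMap.adjoint i ∘ₗ i = LinearMap.id)
    (h : IsEmpty (Fin (Module.finrank ℂ H))) : Subsingleton A :=
  ⟨fun x y => by
    have h1 : (LinearMap.id : A →ₗ[ℂ] A) = 0 :=
      eq_of_comp_unbend_comp_eq hi fun a => h.elim a
    exact (LinearMap.congr_fun h1 x).trans (LinearMap.congr_fun h1 y).symm⟩

/-- One unitarity equation is the unit relation for `X`. The other concerns endomorphisms of `A`;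
placed between `P_ac` and `P_ed†` it becomes the multiplication relation. -/
theorem isUnitaryFamily_unbend (hX : IsMatrixUnitFamily X)
    (hi : LinearMap.adjoint i ∘ₗ i = LinearMap.id)
    (hii : i ∘ₗ LinearMap.adjoint i = bentFamily H X) :
    IsUnitaryFamily (comp (stdOrthonormalBasis ℂ H) (unbend i)) where
  comp_adjoint j k := by
    simp only [comp_unbend_comp_adjoint hii, hX.unit]
  adjoint_comp j k := by
    -- Joint injectivity of the components means, after taking adjoints, that their adjoints can be
    -- cancelled on the right.
    have right_ext : ∀ {S T : A →ₗ[ℂ] V}, (∀ a c,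
        S ∘ₗ LinearMap.adjoint (comp (stdOrthonormalBasis ℂ H) (unbend i) a c) =
        T ∘ₗ LinearMap.adjoint (comp (stdOrthonormalBasis ℂ H) (unbend i) a c)) → S = T := by
      intro S T h
      apply LinearMap.adjoint.injective
      refine eq_of_comp_unbend_comp_eq hi fun a c => ?_
      apply LinearMap.adjoint.injective
      simpa only [LinearMap.adjoint_comp, LinearMap.adjoint_adjoint] using h a c
    refine eq_of_comp_unbend_comp_eq hi fun a c => right_ext fun e d => ?_
    have h : ∀ l, comp (stdOrthonormalBasis ℂ H) (unbend i) a c ∘ₗ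
        (LinearMap.adjoint (comp (stdOrthonormalBasis ℂ H) (unbend i) l j) ∘ₗ
          comp (stdOrthonormalBasis ℂ H) (unbend i) l k) ∘ₗ
        LinearMap.adjoint (comp (stdOrthonormalBasis ℂ H) (unbend i) e d) =
        X (a, l) (c, j) ∘ₗ X (l, e) (k, d) := by
      intro l
      rw [← comp_unbend_comp_adjoint hii, ← comp_unbend_comp_adjoint hii]
      rfl
    simp only [LinearMap.comp_assoc, sum_comp_linear, comp_sum_linear] at h ⊢
    simp only [h, hX.mul]
    split_ifs
    · rw [LinearMap.id_comp, comp_unbend_comp_adjoint hii]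
    · simp

end

end SplittingIdempotent

/-! ### The quantum graph and the quantum isomorphism of a simple monoid -/

section Reconstruction

variable {ι V A : Type*} [Fintype ι] [DecidableEq ι]
  [NormedAddCommGroup V] [InnerProductSpace ℂ V] [FiniteDimensional ℂ V]
  [NormedAddCommGroup A] [InnerProductSpace ℂ A] [FiniteDimensional ℂ A]
  {F : ι → ι → A →ₗ[ℂ] V} {X : ι × ι → ι × ι → V →ₗ[ℂ] V}

/-- The factorisation of `X` extends to two wires, so that averaging applies to the multiplication,
whose source is `V ⊗ V`. -/
theorem pairFamily_comp_adjoint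
    (hFX : ∀ a c k d, F a c ∘ₗ LinearMap.adjoint (F k d) = X (a, k) (c, d)) (a b k j : ι) :
    pairFamily F a b ∘ₗ LinearMap.adjoint (pairFamily F k j) = pairFamily X (a, k) (b, j) := by
  rw [adjoint_pairFamily]
  simp only [pairFamily, sum_comp_linear, comp_sum_linear, ← TensorProduct.map_comp, hFX,
    Fintype.sum_prod_type]
  rw [Finset.sum_comm]

theorem comp_average_mul (hF : IsUnitaryFamily F)
    (hFX : ∀ a c k d, F a c ∘ₗ LinearMap.adjoint (F k d) = X (a, k) (c, d))
    {m : V ⊗[ℂ] V →ₗ[ℂ] V} (hm : ∀ p q, X p q ∘ₗ m = m ∘ₗ pairFamily X p q) (a b : ι) :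
    F a b ∘ₗ ((1 / (Fintype.card ι : ℂ)) • ∑ j, ∑ k,
      LinearMap.adjoint (F k j) ∘ₗ m ∘ₗ pairFamily F k j) = m ∘ₗ pairFamily F a b :=
  hF.pair.comp_average (fun a b k j => by
    rw [← LinearMap.comp_assoc, hFX, hm, pairFamily_comp_adjoint hFX]) a b

theorem comp_average_unit
    (hFX : ∀ a c k d, F a c ∘ₗ LinearMap.adjoint (F k d) = X (a, k) (c, d))
    {u : ℂ →ₗ[ℂ] V} (hu : ∀ p q, X p q ∘ₗ u = if p = q then u else 0) (a b : ι) :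
    F a b ∘ₗ ((1 / (Fintype.card ι : ℂ)) • ∑ j, ∑ k,
      LinearMap.adjoint (F k j) ∘ₗ u ∘ₗ (if k = j then LinearMap.id else 0)) =
      if a = b then u else 0 := by
  refine (isUnitaryFamily_scalar.comp_average (fun a b k j => ?_) a b).trans ?_
  · rw [← LinearMap.comp_assoc, hFX, hu]
    by_cases h1 : a = b <;> by_cases h2 : k = j <;> simp [h1, h2]
  · split_ifs <;> simp

theorem comp_average_adj (hF : IsUnitaryFamily F)
    (hFX : ∀ a c k d, F a c ∘ₗ LinearMap.adjoint (F k d) = X (a, k) (c, d))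
    {γ : V →ₗ[ℂ] V} (hγ : ∀ p q, X p q ∘ₗ γ = γ ∘ₗ X p q) (a b : ι) :
    F a b ∘ₗ ((1 / (Fintype.card ι : ℂ)) • ∑ j, ∑ k,
      LinearMap.adjoint (F k j) ∘ₗ γ ∘ₗ F k j) = γ ∘ₗ F a b :=
  hF.comp_average (fun a b k j => by rw [← LinearMap.comp_assoc, hFX, hγ]) a b

end Reconstruction

section Main

variable {V K A H : Type*}
  [NormedAddCommGroup V] [InnerProductSpace ℂ V] [FiniteDimensional ℂ V]
  [NormedAddCommGroup K] [InnerProductSpace ℂ K] [FiniteDimensional ℂ K]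
  [NormedAddCommGroup A] [InnerProductSpace ℂ A] [FiniteDimensional ℂ A]
  [NormedAddCommGroup H] [InnerProductSpace ℂ H] [FiniteDimensional ℂ H]

theorem comp_endBasis_compMap_dualMap (P : H ⊗[ℂ] A →ₗ[ℂ] V ⊗[ℂ] H)
    (a k c d : Fin (Module.finrank ℂ H)) :
    comp (endBasis H) (compMap P (dualMap P)) (a, k) (c, d) =
      comp (stdOrthonormalBasis ℂ H) P a c ∘ₗ
        LinearMap.adjoint (comp (stdOrthonormalBasis ℂ H) P k d) := by
  rw [endBasis, comp_compMap, comp_dualMap]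

/-- The algebra structure transported from `V` to `A` along `P : H ⊗ A → V ⊗ H`. -/
def loopAlg (M : AlgData V) (P : H ⊗[ℂ] A →ₗ[ℂ] V ⊗[ℂ] H) : AlgData A where
  mul := loop (LinearMap.adjoint P ∘ₗ M.mul.rTensor H ∘ₗ pullTwo P)
  unit := loop (LinearMap.adjoint P ∘ₗ M.unit.rTensor H ∘ₗ pullZero H)

/-- Stated for a bare matrix `X` rather than a monoid: the given automorphism lives on `K`, and only
its components in the transported matrix units enter. -/
theorem exists_splitting (Γ : QuantumGraph V)
    {X : Fin (Module.finrank ℂ H) × Fin (Module.finrank ℂ H) →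
      Fin (Module.finrank ℂ H) × Fin (Module.finrank ℂ H) → V →ₗ[ℂ] V}
    (hX : IsMatrixUnitFamily X) (hU : IsUnitaryFamily X)
    (hmul : ∀ p q, X p q ∘ₗ Γ.alg.mul = Γ.alg.mul ∘ₗ pairFamily X p q)
    (hunit : ∀ p q, X p q ∘ₗ Γ.alg.unit = if p = q then Γ.alg.unit else 0)
    (hadj : ∀ p q, X p q ∘ₗ Γ.adj = Γ.adj ∘ₗ X p q)
    {i : A →ₗ[ℂ] HilbDual H ⊗[ℂ] (V ⊗[ℂ] H)}
    (hi : LinearMap.adjoint i ∘ₗ i = LinearMap.id)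
    (hii : i ∘ₗ LinearMap.adjoint i = bentFamily H X) :
    ∃ (ΓX : QuantumGraph A) (P : QuantumIso ΓX Γ H),
      (∀ p q, comp (endBasis H) (compMap P.map (dualMap P.map)) p q = X p q) ∧
      IsSplitting Γ (compMap P.map (dualMap P.map)) ΓX P.map i := by
  have hF := isUnitaryFamily_unbend hX hi hii
  have hFX := comp_unbend_comp_adjoint hii
  have hY : ∀ p q, comp (endBasis H) (compMap (unbend i) (dualMap (unbend i))) p q = X p q := by
    rintro ⟨a, k⟩ ⟨c, d⟩
    rw [comp_endBasis_compMap_dualMap, hFX]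
  have hbend : bendEndo (compMap (unbend i) (dualMap (unbend i))) = bentFamily H X := by
    rw [bendEndo_eq]
    simp only [hY]
    rfl
  have hM : ∀ a b, comp (stdOrthonormalBasis ℂ H) (unbend i) a b ∘ₗ
      (loopAlg Γ.alg (unbend i)).mul =
      Γ.alg.mul ∘ₗ pairFamily (comp (stdOrthonormalBasis ℂ H) (unbend i)) a b := by
    intro a b
    simp only [loopAlg, loop_adjoint_comp, comp_pullTwo_eq_pairFamily]
    exact comp_average_mul hF hFX hmul a b
  have hu : ∀ a b, comp (stdOrthonormalBasis ℂ H) (unbend i) a b ∘ₗ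
      (loopAlg Γ.alg (unbend i)).unit = if a = b then Γ.alg.unit else 0 := by
    intro a b
    simp only [loopAlg, loop_adjoint_comp, comp_pullZero]
    exact comp_average_unit hFX hunit a b
  have hγ : ∀ a b, comp (stdOrthonormalBasis ℂ H) (unbend i) a b ∘ₗ
      loop (LinearMap.adjoint (unbend i) ∘ₗ Γ.adj.rTensor H ∘ₗ unbend i) =
      Γ.adj ∘ₗ comp (stdOrthonormalBasis ℂ H) (unbend i) a b := by
    intro a b
    rw [loop_adjoint_comp]
    exact comp_average_adj hF hFX hadj a b
  let ΓX : QuantumGraph A := Γ.ofUnitaryFamily hF (subsingleton_of_isEmpty hi)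
    (loopAlg Γ.alg (unbend i)) _ hM hu hγ
  let P : QuantumIso ΓX Γ H :=
    QuantumIso.ofUnitaryFamily (stdOrthonormalBasis ℂ H) (unbend i) hF hM hu hγ
  refine ⟨ΓX, P, hY, ?_⟩
  exact
    { bend_selfAdjoint := by
        change LinearMap.adjoint (bendEndo (compMap (unbend i) (dualMap (unbend i)))) =
          bendEndo (compMap (unbend i) (dualMap (unbend i)))
        rw [hbend, adjoint_bentFamily hX hU]
      bend_idem := by
        change bendEndo (compMap (unbend i) (dualMap (unbend i))) ∘ₗ
          bendEndo (compMap (unbend i) (dualMap (unbend i))) =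
          bendEndo (compMap (unbend i) (dualMap (unbend i)))
        rw [hbend, bentFamily_comp_self hX]
      isometry := hi
      splits := hii.trans hbend.symm
      map_eq := rfl
      -- The structure maps of `ΓX` were defined as these loops; the content lies in `hM`, `hu` and
      -- `hγ`.
      mul_eq := rfl
      unit_eq := rfl
      adj_eq := rfl }

theorem isMatrixUnitFamily_iff_endAlg
    (Y : (H ⊗[ℂ] HilbDual H) ⊗[ℂ] V →ₗ[ℂ] V ⊗[ℂ] (H ⊗[ℂ] HilbDual H)) :
    IsMatrixUnitFamily (comp (endBasis H) Y) ↔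
      IsIntertwiner (compMap Y Y) Y (endAlg H).mul ∧ IsIntertwiner (idMap V) Y (endAlg H).unit := by
  have hs : ∀ h : Nonempty (Fin (Module.finrank ℂ H)), endScalar H * sqrtDim H ≠ 0 := fun h => by
    rw [endScalar_mul_sqrt h]; exact one_ne_zero
  rw [isIntertwiner_mul_iff (endBasis H) (endAlg H) (fun h => left_ne_zero_of_mul (hs h))
    endAlg_mul_basis, isIntertwiner_unit_iff (endBasis H) (endAlg H)
    (fun h => right_ne_zero_of_mul (hs h)) endAlg_unit_one]
  exact ⟨fun h => ⟨h.mul, h.unit⟩, fun h => ⟨h.1, h.2⟩⟩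

/-- As `f` is an injective homomorphism, the vectors `k p` multiply like the matrix units to which
`f` sends them, so the intertwiner conditions become the matrix unit relations. -/
theorem FrobeniusMonoid.isMatrixUnitFamily {Γ : QuantumGraph V} (X : FrobeniusMonoid Γ K)
    (k : OrthonormalBasis (Fin (Module.finrank ℂ H) × Fin (Module.finrank ℂ H)) ℂ K)
    {f : K →ₗ[ℂ] H ⊗[ℂ] HilbDual H} (hf : IsStarIso X.alg (endAlg H) f)
    (hinj : Function.Injective f) (hk : ∀ p, f (k p) = endBasis H p) :
    IsMatrixUnitFamily (comp k X.iso.map) := by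
  have hs : ∀ h : Nonempty (Fin (Module.finrank ℂ H)), endScalar H * sqrtDim H ≠ 0 := fun h => by
    rw [endScalar_mul_sqrt h]; exact one_ne_zero
  have hmul : ∀ a b c d, X.alg.mul (k (a, b) ⊗ₜ k (c, d)) =
      if b = c then endScalar H • k (a, d) else 0 := by
    intro a b c d
    apply hinj
    have := LinearMap.congr_fun hf.starHom.map_mul (k (a, b) ⊗ₜ k (c, d))
    simp only [LinearMap.comp_apply, TensorProduct.map_tmul, hk, endAlg_mul_basis] at this
    rw [this]
    split_ifs <;> simp [hk]
  have hunit : X.alg.unit 1 = sqrtDim H • ∑ a, k (a, a) := by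
    apply hinj
    have := LinearMap.congr_fun hf.starHom.map_unit 1
    rw [LinearMap.comp_apply, endAlg_unit_one] at this
    simp [this, hk]
  exact ⟨(isIntertwiner_mul_iff k X.alg (fun h => left_ne_zero_of_mul (hs h)) hmul _).1
    X.mul_intertwiner, (isIntertwiner_unit_iff k X.alg (fun h => right_ne_zero_of_mul (hs h))
    hunit _).1 X.unit_intertwiner⟩

end Main

end

end QuantumGraphs

/-! ### Proof of the main theorem -/

theorem mainTheorem2 {V K : Type u}
    [NormedAddCommGroup V] [InnerProductSpace ℂ V] [FiniteDimensional ℂ V]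
    [NormedAddCommGroup K] [InnerProductSpace ℂ K] [FiniteDimensional ℂ K]
    (Γ : QuantumGraphs.QuantumGraph V) (X : QuantumGraphs.FrobeniusMonoid Γ K)
    (hX : X.IsSimple) :
    ∃ (A : Type u) (_ : NormedAddCommGroup A) (_ : InnerProductSpace ℂ A)
      (_ : FiniteDimensional ℂ A)
      (H : Type u) (_ : NormedAddCommGroup H) (_ : InnerProductSpace ℂ H)
      (_ : FiniteDimensional ℂ H)
      (ΓX : QuantumGraphs.QuantumGraph A) (P : QuantumGraphs.QuantumIso ΓX Γ H)
      (Y : QuantumGraphs.FrobeniusMonoid Γ (H ⊗[ℂ] QuantumGraphs.HilbDual H)),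
      -- `Y` is the dagger Frobenius monoid `(H ⊗ H^*, P ∘ P̄)` on the endomorphism algebra of `H`
      Y.iso.map = QuantumGraphs.compMap P.map (QuantumGraphs.dualMap P.map) ∧
      Y.alg = QuantumGraphs.endAlg H ∧
      -- `X` is `*`-isomorphic to `Y` in `QAut(Γ)`
      (∃ f : K →ₗ[ℂ] H ⊗[ℂ] QuantumGraphs.HilbDual H,
        QuantumGraphs.IsIntertwiner X.iso.map Y.iso.map f ∧
        QuantumGraphs.IsStarIso X.alg Y.alg f) ∧
      -- `ΓX` and `P` come from splitting a dagger idempotent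
      (∃ i : A →ₗ[ℂ] QuantumGraphs.HilbDual H ⊗[ℂ] (V ⊗[ℂ] H),
        QuantumGraphs.IsSplitting Γ Y.iso.map ΓX P.map i) := by

  obtain ⟨H, _, _, _, f, hf⟩ := hX
  have hN := QuantumGraphs.endAlg_isDaggerFrobenius H
  let e := hf.toIsometryEquiv X.frobenius hN
  -- Unitarity of `f` makes the pulled-back matrix units orthonormal, as required for taking
  -- components.
  let k := (QuantumGraphs.endBasis H).map e.symm
  have hk : ∀ p, f (k p) = QuantumGraphs.endBasis H p := fun p => by
    change e (k p) = _
    simp [k]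
  have hM := X.isMatrixUnitFamily k hf e.injective hk
  have hU := X.iso.isUnitaryFamily_comp k
  obtain ⟨A, _, _, _, i, hi, hii⟩ := QuantumGraphs.exists_isometry_of_idempotent
    (QuantumGraphs.adjoint_bentFamily hM hU) (QuantumGraphs.bentFamily_comp_self hM)
  obtain ⟨ΓX, P, hP, hsplit⟩ := QuantumGraphs.exists_splitting Γ hM hU (X.iso.comp_mul k)
    (X.iso.comp_unit k) (X.iso.comp_adj k) hi hii
  -- The two automorphisms have equal matrices in bases matched by `f`. Hence `P ∘ P̄` inherits all
  -- properties of `X`, and `f`, whose matrix is the identity, is an intertwiner.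
  have hP' : QuantumGraphs.comp (QuantumGraphs.endBasis H)
      (QuantumGraphs.compMap P.map (QuantumGraphs.dualMap P.map)) =
      QuantumGraphs.comp k X.iso.map := funext fun p => funext fun q => hP p q
  have hint := (QuantumGraphs.isMatrixUnitFamily_iff_endAlg
    (QuantumGraphs.compMap P.map (QuantumGraphs.dualMap P.map))).1 (by rw [hP']; exact hM)
  let Y : QuantumGraphs.FrobeniusMonoid Γ (H ⊗[ℂ] QuantumGraphs.HilbDual H) :=
    { iso := QuantumGraphs.QuantumIso.ofUnitaryFamily (QuantumGraphs.endBasis H)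
        (QuantumGraphs.compMap P.map (QuantumGraphs.dualMap P.map))
        (by rw [hP']; exact hU) (by rw [hP']; exact X.iso.comp_mul k)
        (by rw [hP']; exact X.iso.comp_unit k) (by rw [hP']; exact X.iso.comp_adj k)
      alg := QuantumGraphs.endAlg H
      frobenius := hN
      mul_intertwiner := hint.1
      unit_intertwiner := hint.2 }
  refine ⟨A, _, _, ‹_›, H, _, _, ‹_›, ΓX, P, Y, rfl, rfl, ⟨f, ?_, hf⟩, i, hsplit⟩
  refine (QuantumGraphs.isIntertwiner_iff k (QuantumGraphs.endBasis H) _ _ f).2 fun p q => ?_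
  change ∑ r, _ • QuantumGraphs.comp _
    (QuantumGraphs.compMap P.map (QuantumGraphs.dualMap P.map)) p r = _
  rw [hP', Finset.sum_eq_single q, Finset.sum_eq_single p]
  · simp [hk]
  · intro r _ hr
    simp [hk, hr.symm]
  · simp
  · intro r _ hr
    simp [hk, hr]
  · simp
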